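/- **Conventions.** A snake graph is a sequence of unit square tiles $(G_1,\dots,G_d)$, $d\ge 1$, in which $G_{i+1}$ is glued to the north or east edge of $G_i$ along its south, respectively west, edge $e_i$; a single edge is also a snake graph. A sign function gives each edge a sign $\pm$ so that in every tile north and west agree, south and east agree, and north and south differ. A snake graph is recorded, up to symmetry, by its tiles and the signs $f(e_1),\dots,f(e_{d-1})$. A band graph is obtained from a snake graph by glueing a south or west edge of $G_1$ to the north or east edge of $G_d$ with the same sign; $e_0=e_d$ denotes the glueing edge. In a labeled graph all edges and all tiles carry labels. Graphs are taken up to isomorphism (change of the sign function, reversal of the sequence of tiles, choice of the cutting edge of a band graph), labels being preserved. A labeled snake or band graph is *unpunctured* if it is the graph of a curve (an arc, possibly with self-crossings, or a closed loop, or an arc of $T$ or a boundary segment, which gives a single edge) in a triangulated connected oriented surface $(S,M,T)$ with all marked points on the boundary and at least one arc in $T$: crossing the arc $i$ of $T$ gives a tile with face label $y_{S,M,T,i}$, whose four edges are labeled by the sides of the two triangles at $i$ ($x_{S,M,T,j}$ for an arc $j$, and $1$ for a boundary segment), consecutive tiles being glued along the side of the common triangle which the curve does not cross; this side has sign $-$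 if it is to the left of the curve, and $+$ otherwise. An unlabeled graph is unpunctured if it admits an unpunctured labeling. Let $\mathcal{LR}$ be the free $\mathbb Z[y_{S,M,T,i}]$-module on all isomorphism classes of finite disjoint unions of unpunctured labeled snake and band graphs, where $(S,M,T)$ runs over all such triangulated surfaces, and let $\mathcal R$ be the free abelian group on all isomorphism classes of finite disjoint unions of unpunctured unlabeled snake and band graphs. Both are commutative rings under disjoint union, with unit $\emptyset$. **Resolutions.** Write $G[i,j]$ for the subgraph with tiles $G_i,\dots,G_j$, $\overline G$ for the reversed graph, $A\cup B$ for the graph obtained by glueing, and $(\cdot)^\circ$ for a band graph closed up along the appropriate edge. Write $\ominus_a G$ (respectively $G\,\ominus_a$) for the graph obtained from $G$ by removing everything before its first edge of sign $a$ among the interior edges and the north and east edges of the last tile (respectively everything after its last edge of sign $a$ among the interior edges and the south and west edges of the first tile); this can be a single edge. An *overlap* of $G$ and $G'$ is a pair $G[s,t]$, $G'[s',t']$ of subgraphs that are identified, with signs and labels, and that cannot be extended compatibly by a tile at either end; band graphs are unrolled periodically for this purpose, and signs in the two graphs are compared through the overlap. The *ideal of resolutions* in each ring is generated by all $G_{12}-y_{34}G_{34}-y_{56}G_{56}$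 whose terms lie in the ring, where $G_{12}\mapsto y_{34}G_{34}+y_{56}G_{56}$ is one of the following (in unlabeled rings all $y$ are $1$). 1. Two snake graphs $G,G'$ with $d,d'$ tiles and an overlap which is crossing: $f(e_{s-1})\ne f(e_t)$ with $1<s$, $t<d$; or the same for $G'$; or $f(e_t)=f(e'_{s'-1})$ with $s=1$, $t<d$, $s'>1$, $t'=d'$; or the symmetric condition. $G_{34}=(G[1,s-1]\cup G'[s',d'])\sqcup(G'[1,s'-1]\cup G[s,d])$, $G_{56}=G_5\sqcup G_6$, with $G_5=G[1,s-1]\cup\overline{G'}[s'-1,1]$ and $G_6=\overline{G'}[d',t'+1]\cup G[t+1,d]$; if $s'=1$ then $G_5=G[1,s-1]\ominus_a$, $a=f(e_{s-1})$, if $t'=d'$ then $G_6=\ominus_a G[t+1,d]$, $a=f(e_t)$, and symmetrically. 2. A snake graph $G$ and a band graph $G'$ cut at the beginning $b$ of the overlap $G[s,t]\cong G'[1,t']$, crossing if $f(e_{s-1})\ne f(e_t)$ with $1<s$, $t<d$; or $f(b)\ne f(e'_{t'})$ with $t'<d'$; or $f(e_t)=f(b)$ with $s=1$, $t<d$, $t'=d'$;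 or $f(e_{s-1})=f(e'_{t'})$ with $s>1$, $t=d$, $t'<d'$ (if the overlap is the whole band graph, $G[s,t]$ denotes its largest extension that maps to the unrolled band graph). $G_{34}=G[1,s-1]\cup G'\cup G[s,d]$ and $G_{56}=H=G[1,s-1]\cup\overline{G'}[d',t'+1]\cup G[t+1,d]$, with $H$ replaced by $\ominus_{-f(b)}H$ if $s=1$, by $H\ominus_{-f(e'_{t'})}$ if $t=d$, and by both, in the order in which the cut exists as a cut along an interior edge, if $s=1$ and $t=d$ (the boundary edge in the south and west of $G'_1$, if $H$ is a single tile); if the overlap is the whole band graph, $G_{56}$ is $G$ with one copy of $G'$ removed. 3. Two band graphs with overlap $G[1,t]\cong G'[1,t']$, $t<d$, crossing if $f(b)\ne f(e'_{t'})$ with $t'<d'$, or $f(e_t)=f(b)$ and $t'=d'$, where $b$ is the edge of $G'$ before the overlap. $G_{34}=(G\cup G')^\circ$, $G_{56}=(G[t+1,d]\cup\overline{G'}[d',t'+1])^\circ$ (respectively $G$ with one copy of $G'$ removed). 4. A band graph with self-overlap $G[1,t]\cong G[s',t']$, $t'\le d$ (if the overlap is the whole graph, $t=d$ and $G[s',t']$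 is $G$ cut before $G_{s'}$, with $2s'-2\le d$). Same direction, crossing if $f(e_t)=f(e_{s'-1})$, and $f(e_{s'-1})\ne f(e_{t'})$ if $t'<d$ and the overlap is not the whole graph: $G_{34}=G[s',d]^\circ\sqcup G[1,s'-1]^\circ$ and $G_{56}=-G[2s'-1,d]^\circ$ if $s'\le t$ (or $-2$ if $2s'-2=d$); $(\overline G[s'-1,t+1]\cup G[t'+1,d])^\circ$ if $s'>t+1$, $t'<d$; $-\emptyset$ if $s'=t+1$, $t'=d$; and if $s'=t+1$, $t'<d$, with $\ell\ge1$ minimal such that $f(e_{t'+\ell})=f(e_{d-\ell})$, $\pm G[t'+\ell+1,d-\ell]^\circ$, $\pm\emptyset$ or $0$ according as $d-t'-2\ell$ is positive, zero or negative, with sign $+$ if and only if $f(e_{t'})=f(e_{t'+\ell})$. Opposite direction, with tiles between the two copies on both sides, crossing if $f(e_t)=f(e_{s'-1})\ne f(e_{t'})$: $G_{34}=(G[1,t]\cup\overline G[s'-1,t+1]\cup G[s',d])^\circ$, $G_{56}=G[t'+1,d]^\circ\sqcup G[t+1,s'-1]^\circ$. 5. A snake graph with self-overlap $G[s,t]\cong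 G[s',t']$, $s<s'$. Same direction, crossing if $f(e_{s-1})\ne f(e_t)$ with $s>1$, or $f(e_{s'-1})\ne f(e_{t'})$ with $t'<d$, or $f(e_t)=f(e_{s'-1})$ with $s=1$, $t'=d$: $G_{34}=(G[1,s-1]\cup G[s',d])\sqcup G[s,s'-1]^\circ$ and $G_{56}=-(G[1,s-1]\cup G[2s'-s,d])$ if $s'\le t$; $H=G[1,s-1]\cup\overline G[s'-1,t+1]\cup G[t'+1,d]$ if $s'>t+1$, cut to $\ominus_{-f(e_{s'-1})}H$ if $s=1$, to $H\ominus_{-f(e_t)}$ if $t'=d$, and at both ends if both hold ($0$ if the first cut is not along an interior edge); if $s'=t+1$: minus the north or east edge of $G_t$ of sign $f(e_t)$ if $s=1$, $t'=d$; $-\ominus_{-f(e_{t'})}G[t'+1,d]$ if $s=1$, $t'<d$; $-G[1,s-1]\ominus_{-f(e_{s-1})}$ if $s>1$, $t'=d$; and otherwise, with $\ell\ge1$ minimal such that $\ell=s-1$ or $\ell=d-t'$ or $f(e_{t'+\ell})=f(e_{s-1-\ell})$: $\pm(G[1,s-1-\ell]\cup G[t'+\ell+1,d])$ if $\ell<s-1$,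 $\ell<d-t'$; $\pm\ominus_a G[t'+\ell+1,d]$ with $a=f(e_{t'+\ell})$ if $\ell=s-1<d-t'$; $\pm G[1,s-1-\ell]\ominus_a$ with $a=f(e_{s-1-\ell})$ if $\ell=d-t'<s-1$; $0$ if $\ell=s-1=d-t'$; the sign is $+$ if and only if $f(e_{t'})=f(e_{t'+\ell})$ (in the third case, $f(e_{s-1})=f(e_{s-1-\ell})$). Opposite direction, with tiles between the two copies, crossing if $f(e_{s-1})\ne f(e_t)$ with $s>1$, or $f(e_{t'})\ne f(e_{s'-1})$ with $t'<d$: $G_{34}=G[1,t]\cup\overline G[s'-1,t+1]\cup G[s',d]$, $G_{56}=G_5\sqcup G[t+1,s'-1]^\circ$, where $G_5=G[1,s-1]\cup G[t'+1,d]$ if $s>1$, $t'<d$; $G[1,s-1]\ominus_{f(e_{s-1})}$ if $t'=d$; $\ominus_{f(e_{t'})}G[t'+1,d]$ if $s=1$. 6. Graftings. Here $G_s$ and $G'_1$ can be glued along edges of sign $g$ so that the glued edges have equal labels and in each of these tiles the other edge (of the pair north/east, respectively south/west) is labeled $x_i$, where $y_i$ is the face label of the other tile. For two snake graphs: if $s<d$,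 $g=-f(e_s)$, and also $G'_1$, reversed, can be glued in this way to $G_{s+1}$, then $G_{34}=(G[1,s]\cup G')\sqcup\ominus_gG[s+1,d]$, $G_{56}=G[1,s]\ominus_g\sqcup(\overline{G'}\cup G[s+1,d])$; if $s=d$, then $G_{34}=(G\cup G')\sqcup\{\text{edge of }G_d\text{ of sign }g\}$, $G_{56}=G\ominus_g\sqcup\ominus_gG'$. Self-grafting ($G'_1=G_1$): if $s<d$, $G_{34}=\ominus_gG[s+1,d]\sqcup G[1,s]^\circ$, $G_{56}=\ominus_{-g}(\overline G[s,1]\cup G[s+1,d])$; if $s=d$, $G_{34}=\{\text{edge of }G_d\text{ of sign }g\}\sqcup G^\circ$ and $G_{56}$ is $G$ cut at both ends at edges of sign $g$ ($0$ if $G$ has no interior edge of sign $g$). A snake graph $G$ and a band graph $G'$ with glueing edge $b$ ($G'_1$, and $G'_{d'}$ reversed, can be glued to $G_d$ in this way): $G_{34}=(G\cup G')\ominus_{-f(b)}$, $G_{56}=(G\cup\overline{G'})\ominus_{f(b)}$. A single edge labeled as the edge of sign $-f(b)$ in the north and east of $G'_{d'}$, and the band graph $G'$: $G_{34}=\ominus_{-f(b)}G'$,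 $G_{56}=\ominus_{f(b)}(G'\ominus_{-f(b)})$. A single edge labeled $x_i$, and a snake graph $G$ with a tile $G_k$ with face label $y_i$: $G_{34}=G[1,k]\ominus_-\sqcup\ominus_+G[k,d]$, $G_{56}=G[1,k]\ominus_+\sqcup\ominus_-G[k,d]$. The monomials $y_{34}$, $y_{56}$ are determined as follows. A cut $G\,\ominus_+$ or $\ominus_-G$ contributes the product of the face labels of the tiles it removes (in the last grafting, $y_i$ counted once), and $G\,\ominus_-$, $\ominus_+G$ contribute $1$. In 1–5, $y_{34}=1$, and $y_{56}$ moreover contains the face labels of the tiles of the overlap $G[s,t]$, or, where one copy of a band graph is removed or $s'\le t$, of the tiles of one period ($G'$, respectively $G[s,s'-1]$); for $s'=t+1$ with $\ell$ as above it contains those of the overlap and of the $\ell$ tiles preceding it. Let $\mathcal{LS}=\mathcal{LR}/I_{\mathcal{LR}}$ (the snake ring) and $\mathcal S=\mathcal R/I_{\mathcal R}$ (the unlabeled snake ring) be the quotients by the ideals of resolutions. **Corollary (forgetting labels).** Forgetting the labels gives a well-defined ring homomorphism $\mathcal{LS}\to\mathcal S$. That is, there is a unique ring homomorphism $\mathcal{LS}\to\mathcal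 S$ which sends every coefficient $y_{S,M,T,i}$ to $1$ and the class of every disjoint union of unpunctured labeled snake and band graphs to the class of the same union without labels. -/

import Mathlib

namespace SnakeCalculus

/-! ### Tiles, words, snake graphs and band graphs

Signs are Booleans: `false` is the sign `-` and `true` is the sign `+`. A snake or band graph is
recorded by its sequence of tiles together with a sign function, which determines it up to
symmetry of the plane. -/

/-- A labelled tile with a sign function. In each of the two pairs {south, west} and
{north, east} one edge has sign `-` and the other has sign `+`; `inn σ` is the label of the edge of
sign `σ` in {south, west} and `out σ` the label of the edge of sign `σ` in {north, east}. -/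
@[ext]
structure Tile (X Y : Type) where
  face : Y
  inn : Bool → X
  out : Bool → X

namespace Tile

variable {X Y X' Y' : Type}

/-- The same tile with the opposite sign function. -/
def flip (T : Tile X Y) : Tile X Y :=
  ⟨T.face, fun s => T.inn (!s), fun s => T.out (!s)⟩

/-- The tile traversed from north-east to south-west, with the opposite sign function. -/
def turn (T : Tile X Y) : Tile X Y :=
  ⟨T.face, fun s => T.out (!s), fun s => T.inn (!s)⟩

/-- Relabelling of a tile. -/
def map (f : X → X') (g : Y → Y') (T : Tile X Y) : Tile X' Y' :=
  ⟨g T.face, fun s => f (T.inn s), fun s => f (T.out s)⟩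

end Tile

/-- A word `[(G₁, e₁), (G₂, e₂), …, (G_d, e_d)]`: each tile `G_i` is followed by the sign of the edge
`e_i` which it shares with the next tile. The edge `e_i` is the edge of this sign among the north
and east edges of `G_i`, and also among the south and west edges of `G_{i+1}`. -/
abbrev Word (X Y : Type) := List (Tile X Y × Bool)

/-- Relabelling of a word. -/
def mapWord {X Y X' Y' : Type} (f : X → X') (g : Y → Y') (w : Word X Y) : Word X' Y' :=
  w.map fun p => (p.1.map f g, p.2)

/-- The same word with the opposite sign function. -/
def flipWord {X Y : Type} (w : Word X Y) : Word X Y :=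
  w.map fun p => (p.1.flip, !p.2)

/-- The opposite sequence of tiles, with the opposite sign function; the sign after the last tile
of the new word is `c`. -/
def turnWord {X Y : Type} (c : Bool) (w : Word X Y) : Word X Y :=
  (w.map fun p => p.1.turn).reverse.zip ((w.dropLast.map fun p => !p.2).reverse ++ [c])

/-- Replace the sign after the last tile by `c`. -/
def withEnd {X Y : Type} (c : Bool) (w : Word X Y) : Word X Y :=
  match w.getLast? with
  | none => []
  | some p => w.dropLast ++ [(p.1, c)]

/-- Presentations of connected snake and band graphs with edge labels in `X` and face labels in
`Y`: a single edge; the snake graph with a given (nonempty) word, where the sign after the last tile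
carries no information; the band graph with a given (nonempty) cyclic word, where the sign after the
last tile is the sign of the glueing edge. -/
inductive ConnGraph (X Y : Type) : Type
  | edge (x : X)
  | snake (w : Word X Y)
  | band (w : Word X Y)

/-- Relabelling of a graph. -/
def ConnGraph.map {X Y X' Y' : Type} (f : X → X') (g : Y → Y') :
    ConnGraph X Y → ConnGraph X' Y'
  | .edge x => .edge (f x)
  | .snake w => .snake (mapWord f g w)
  | .band w => .band (mapWord f g w)

/-- Elementary isomorphisms between presentations: the meaningless last sign of a snake graph,
the other sign function, the opposite sequence of tiles, and for band graphs the choice of the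
interior edge along which the graph is cut. -/
inductive Step {X Y : Type} : ConnGraph X Y → ConnGraph X Y → Prop
  | snakeEnd (w : Word X Y) (c : Bool) : Step (.snake w) (.snake (withEnd c w))
  | snakeFlip (w : Word X Y) : Step (.snake w) (.snake (flipWord w))
  | snakeTurn (w : Word X Y) (c : Bool) : Step (.snake w) (.snake (turnWord c w))
  | bandRotate (w : Word X Y) (p : Tile X Y × Bool) : Step (.band (w ++ [p])) (.band (p :: w))
  | bandFlip (w : Word X Y) : Step (.band w) (.band (flipWord w))
  | bandTurn (w : Word X Y) (T : Tile X Y) (e : Bool) :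
      Step (.band (w ++ [(T, e)])) (.band (turnWord (!e) (w ++ [(T, e)])))

/-- Isomorphism classes of connected labelled snake and band graphs. -/
def ConnClass (X Y : Type) : Type := Quot (@Step X Y)

/-- The isomorphism class of a graph. -/
def ConnClass.mk {X Y : Type} (g : ConnGraph X Y) : ConnClass X Y := Quot.mk _ g

section MapLemmas

variable {X Y X' Y' : Type} (f : X → X') (g : Y → Y')

theorem mapWord_flipWord (w : Word X Y) :
    mapWord f g (flipWord w) = flipWord (mapWord f g w) := by
  simp [mapWord, flipWord, Tile.map, Tile.flip]

theorem mapWord_turnWord (c : Bool) (w : Word X Y) :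
    mapWord f g (turnWord c w) = turnWord c (mapWord f g w) := by
  have h1 : (fun p : Tile X Y × Bool => (p.1.map f g, p.2)) =
      Prod.map (Tile.map f g) id := rfl
  unfold mapWord turnWord
  rw [h1, ← List.zip_map, List.map_id, ← List.map_dropLast, List.map_map, List.map_map,
    List.map_reverse, List.map_map]
  rfl

theorem mapWord_withEnd (c : Bool) (w : Word X Y) :
    mapWord f g (withEnd c w) = withEnd c (mapWord f g w) := by
  rcases List.eq_nil_or_concat w with rfl | ⟨l, p, rfl⟩
  · rfl
  · simp [mapWord, withEnd]

theorem Step.map {G H : ConnGraph X Y} (h : Step G H) : Step (G.map f g) (H.map f g) := by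
  cases h with
  | snakeEnd w c =>
    simp only [ConnGraph.map, mapWord_withEnd]; exact .snakeEnd _ _
  | snakeFlip w => simp only [ConnGraph.map, mapWord_flipWord]; exact .snakeFlip _
  | snakeTurn w c => simp only [ConnGraph.map, mapWord_turnWord]; exact .snakeTurn _ _
  | bandRotate w p =>
    simp only [ConnGraph.map, mapWord, List.map_append, List.map_cons, List.map_nil]
    exact .bandRotate _ _
  | bandFlip w => simp only [ConnGraph.map, mapWord_flipWord]; exact .bandFlip _
  | bandTurn w T e =>
    simp only [ConnGraph.map, mapWord_turnWord]
    simp only [mapWord, List.map_append, List.map_cons, List.map_nil]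
    exact .bandTurn _ _ _

end MapLemmas

/-- Relabelling of isomorphism classes. -/
def ConnClass.map {X Y X' Y' : Type} (f : X → X') (g : Y → Y') :
    ConnClass X Y → ConnClass X' Y' :=
  Quot.map (ConnGraph.map f g) fun _ _ h => h.map f g

/-! ### Label systems and the ring of graphs -/

/-- The data over which a snake ring is formed: sets `X` of edge labels and `Y` of face labels, the
edge label `xOf i` with the same index as the face label `i`, a coefficient ring `K` in which the
face labels are evaluated, and the class of graphs which generate the ring. -/
structure LabelSystem where
  X : Type
  Y : Type
  K : Type
  ring : CommRing K
  xOf : Y → X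
  y : Y → K
  Adm : ConnGraph X Y → Prop

attribute [instance] LabelSystem.ring

/-- The free `K`-module on all finite disjoint unions (multisets) of isomorphism classes of
connected graphs, with disjoint union as multiplication. -/
abbrev FullRing (L : LabelSystem) : Type := MvPolynomial (ConnClass L.X L.Y) L.K

/-- Isomorphism classes of connected graphs of the given class. -/
abbrev AdmClass (L : LabelSystem) : Type :=
  {c : ConnClass L.X L.Y // ∃ g, L.Adm g ∧ ConnClass.mk g = c}

/-- The free `K`-module on all finite disjoint unions of isomorphism classes of connected graphs of
the given class, with disjoint union as multiplication. -/
abbrev GraphRing (L : LabelSystem) : Type := MvPolynomial (AdmClass L) L.K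

/-- The inclusion into the ring of all graphs. -/
noncomputable def incl (L : LabelSystem) : GraphRing L →ₐ[L.K] FullRing L :=
  MvPolynomial.rename Subtype.val

section Terms

variable (L : LabelSystem)

/-- A connected graph as an element of the ring. -/
noncomputable def gr (g : ConnGraph L.X L.Y) : FullRing L := MvPolynomial.X (ConnClass.mk g)

/-- The product of the face labels of the tiles of a word. -/
def yProd (w : Word L.X L.Y) : L.K := (w.map fun p => L.y p.1.face).prod

/-- The product of the face labels, as a coefficient. -/
noncomputable def yC (w : Word L.X L.Y) : FullRing L := MvPolynomial.C (yProd L w)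

end Terms

/-! ### Cutting off ends: `G ∖ succ(e)` and `G ∖ pred(e)` -/

/-- The word of `G ∖ succ(e)`, where `e` is the last interior edge of sign `a` (empty if there is no
such interior edge). -/
def lastCut {X Y : Type} (a : Bool) (w : Word X Y) : Word X Y :=
  w.dropLast.rdropWhile fun p => p.2 != a

/-- The word of `G ∖ pred(e)`, where `e` is the first interior edge of sign `a` (empty if there is no
such interior edge). -/
def firstCut {X Y : Type} (a : Bool) (w : Word X Y) : Word X Y :=
  (w.dropWhile fun p => p.2 != a).tail

section Cuts

variable (L : LabelSystem)

/-- `G ∖ succ(e)`, where `e` is the last edge of sign `a` among the interior edges and the south and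
west edges of the first tile. It is only used for nonempty words. -/
noncomputable def grSucc (a : Bool) (w : Word L.X L.Y) : FullRing L :=
  match w, lastCut a w with
  | [], _ => 0
  | p :: _, [] => gr L (.edge (p.1.inn a))
  | _ :: _, q :: l => gr L (.snake (q :: l))

/-- `G ∖ pred(e)`, where `e` is the first edge of sign `a` among the interior edges and the north and
east edges of the last tile. It is only used for nonempty words. -/
noncomputable def grPred (a : Bool) (w : Word L.X L.Y) : FullRing L :=
  match w.getLast?, firstCut a w with
  | none, _ => 0
  | some p, [] => gr L (.edge (p.1.out a))
  | some _, q :: l => gr L (.snake (q :: l))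

/-- The tiles removed in `G ∖ succ(e)` if `a` is the sign `+`, and nothing otherwise. -/
def remSucc {X Y : Type} (a : Bool) (w : Word X Y) : Word X Y :=
  if a = true then w.drop (lastCut a w).length else []

/-- The tiles removed in `G ∖ pred(e)` if `a` is the sign `-`, and nothing otherwise. -/
def remPred {X Y : Type} (a : Bool) (w : Word X Y) : Word X Y :=
  if a = false then w.take (w.length - (firstCut a w).length) else []

/-- `G ∖ succ(e)` weighted by its coefficient: the perfect matchings of the remaining graph are
completed by the matching of the removed tiles which is maximal if `a` is the sign `+`, and minimal
if `a` is the sign `-`. -/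
noncomputable def tSucc (a : Bool) (w : Word L.X L.Y) : FullRing L :=
  yC L (remSucc a w) * grSucc L a w

/-- `G ∖ pred(e)` weighted by its coefficient: the perfect matchings of the remaining graph are
completed by the matching of the removed tiles which is maximal if `a` is the sign `-`, and minimal
if `a` is the sign `+`. -/
noncomputable def tPred (a : Bool) (w : Word L.X L.Y) : FullRing L :=
  yC L (remPred a w) * grPred L a w

/-- Both ends cut off: `G ∖ pred(e) ∖ succ(e')`, where `e` is the first interior edge of sign `a` and
`e'` the last edge of sign `a` in what remains; zero if there is no interior edge of sign `a`. -/
noncomputable def tMid (a : Bool) (w : Word L.X L.Y) : FullRing L :=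
  if firstCut a w = [] then 0 else yC L (remPred a w) * tSucc L a (firstCut a w)

end Cuts

/-! ### Overlaps -/

/-- Two-sided infinite words; a band graph with `d` tiles is unrolled to a `d`-periodic one. -/
abbrev BiWord (X Y : Type) := ℤ → Tile X Y × Bool

/-- The part `G[i, j]` of a two-sided infinite word. -/
def seg {X Y : Type} (A : BiWord X Y) (i j : ℤ) : Word X Y :=
  (List.range (j + 1 - i).toNat).map fun k => A (i + k)

/-- The opposite sequence of tiles, with the opposite sign function: the tile in position `-i` moves
to position `i`. -/
def BiWord.turn {X Y : Type} (A : BiWord X Y) : BiWord X Y :=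
  fun i => ((A (-i)).1.turn, !(A (-i - 1)).2)

/-- The subgraphs with tiles `A_i, …, A_{i+m}` and `B_j, …, B_{j+m}` are equal as labelled graphs
with sign functions. -/
def Agree {X Y : Type} (A B : BiWord X Y) (i j m : ℤ) : Prop :=
  (∀ k : ℤ, 0 ≤ k → k ≤ m → (A (i + k)).1 = (B (j + k)).1) ∧
    ∀ k : ℤ, 0 ≤ k → k < m → (A (i + k)).2 = (B (j + k)).2

/-- `A_i, …, A_{i+m}` and `B_j, …, B_{j+m}` form an overlap, that is, the two subgraphs are equal and
cannot be extended compatibly. The propositions `pre` and `post` say that both graphs continue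
before, respectively after, the overlap. -/
def MaxAgree {X Y : Type} (A B : BiWord X Y) (i j m : ℤ) (pre post : Prop) : Prop :=
  0 ≤ m ∧ Agree A B i j m ∧ ¬ (pre ∧ Agree A B (i - 1) (j - 1) (m + 1)) ∧
    ¬ (post ∧ Agree A B i j (m + 1))

section Inputs

variable (L : LabelSystem)

/-- `A₁, …, A_d` are the tiles of a snake graph of the given class. -/
def IsSnake (A : BiWord L.X L.Y) (d : ℤ) : Prop := 1 ≤ d ∧ L.Adm (.snake (seg A 1 d))

/-- `A` is the unrolling of a band graph of the given class with tiles `A₁, …, A_d`. -/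
def IsBand (A : BiWord L.X L.Y) (d : ℤ) : Prop :=
  1 ≤ d ∧ (∀ i, A (i + d) = A i) ∧ L.Adm (.band (seg A 1 d))

/-- The grafting condition on labels, when the edge of sign `g` in the north-east of the tile `P` is
glued to the edge of sign `g` in the south-west of the tile `Q`: the two edges have the same label,
and the label of the other edge of each of the tiles has the index of the face of the other tile. -/
def JoinLabels (P Q : Tile L.X L.Y) (g : Bool) : Prop :=
  P.out g = Q.inn g ∧ Q.inn (!g) = L.xOf P.face ∧ P.out (!g) = L.xOf Q.face

end Inputs

/-! ### The graphs `G₅`, `G₆`, `G₅₆` in the resolutions -/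

section Resolved

variable (L : LabelSystem) (A B : BiWord L.X L.Y)

/-- `G₅` for two snake graphs crossing in `A[s,t] = B[s',t']`, with its coefficient. -/
noncomputable def pairG5 (s s' : ℤ) : FullRing L :=
  if 1 < s then
    if 1 < s' then
      gr L (.snake (withEnd (!(A (s - 1)).2) (seg A 1 (s - 1)) ++
        turnWord true (seg B 1 (s' - 1))))
    else tSucc L (A (s - 1)).2 (seg A 1 (s - 1))
  else tSucc L (B (s' - 1)).2 (seg B 1 (s' - 1))

/-- `G₆` for two snake graphs crossing in `A[s,t] = B[s',t']`, with its coefficient. -/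
noncomputable def pairG6 (d d' t t' : ℤ) : FullRing L :=
  if t < d then
    if t' < d' then
      gr L (.snake (turnWord (!(A t).2) (seg B (t' + 1) d') ++ seg A (t + 1) d))
    else tPred L (A t).2 (seg A (t + 1) d)
  else tPred L (B t').2 (seg B (t' + 1) d')

/-- The word of `G₅₆'` for the snake graph `A` and the band graph `B` crossing in
`A[s,t] = B[1,t-s+1]`, an overlap which is not the whole band graph. -/
def snakeBandWord (d d' s t : ℤ) : Word L.X L.Y :=
  withEnd (!(A (s - 1)).2) (seg A 1 (s - 1)) ++
    turnWord (B (t - s + 1)).2 (seg B (t - s + 2) d') ++ seg A (t + 1) d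

/-- `G₅₆` for the snake graph `A` and the band graph `B`, with the part of its coefficient which does
not come from the overlap; here `l` is the word of `G₅₆'`, `b` the sign of the edge of the band
graph before the overlap and `κ` the sign of the edge of the band graph after the overlap. -/
noncomputable def snakeBandG56 (d s t : ℤ) (b κ : Bool) (l : Word L.X L.Y) : FullRing L :=
  if 1 < s then
    if t < d then gr L (.snake l) else tSucc L (!κ) l
  else if t < d then tPred L (!b) l
  else if firstCut (!b) l ≠ [] then yC L (remPred (!b) l) * tSucc L (!κ) (firstCut (!b) l)
  else if lastCut (!κ) l ≠ [] then yC L (remSucc (!κ) l) * tPred L (!b) (lastCut (!κ) l)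
  else yC L (remPred (!b) l) * gr L (.edge ((B 1).1.inn (!b)))

/-- `±1` according to whether two signs agree. -/
noncomputable def eqSign (a b : Bool) : FullRing L := if a = b then 1 else -1

/-- `G₅₆` for a snake graph with crossing self-overlap `A[s,t] = A[s',t']` in the same direction with
at least one tile between the two copies, without the coefficient of the overlap. -/
noncomputable def selfG56 (d s t s' t' : ℤ) : FullRing L :=
  let l := withEnd (!(A (s - 1)).2) (seg A 1 (s - 1)) ++
    turnWord (A t).2 (seg A (t + 1) (s' - 1)) ++ seg A (t' + 1) d
  if 1 < s then
    if t' < d then gr L (.snake l) else tSucc L (!(A t).2) l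
  else if t' < d then tPred L (!(A (s' - 1)).2) l
  else tMid L (!(A t).2) l

/-- `G₅₆` for a snake graph with crossing self-overlap `A[s,t] = A[t+1,t']` with `1 < s`, `t' < d`,
where `ℓ` is the number of steps after which the two ends of the graph, followed away from the
overlap, cease to be opposite; without the coefficient. -/
noncomputable def adjacentG56 (d s t' ℓ : ℤ) : FullRing L :=
  if ℓ < s - 1 then
    if ℓ < d - t' then
      eqSign L (A t').2 (A (t' + ℓ)).2 *
        gr L (.snake (withEnd (!(A (s - 1 - ℓ)).2) (seg A 1 (s - 1 - ℓ)) ++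
          seg A (t' + ℓ + 1) d))
    else eqSign L (A (s - 1)).2 (A (s - 1 - ℓ)).2 *
        tSucc L (A (s - 1 - ℓ)).2 (seg A 1 (s - 1 - ℓ))
  else if ℓ < d - t' then
    eqSign L (A t').2 (A (t' + ℓ)).2 * tPred L (A (t' + ℓ)).2 (seg A (t' + ℓ + 1) d)
  else 0

/-- `G₅` for a snake graph with crossing self-overlap `A[s,t] = A[s',t']` in the opposite
direction. -/
noncomputable def oppositeG5 (d s t' : ℤ) : FullRing L :=
  if 1 < s then
    if t' < d then
      gr L (.snake (withEnd (!(A (s - 1)).2) (seg A 1 (s - 1)) ++ seg A (t' + 1) d))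
    else tSucc L (A (s - 1)).2 (seg A 1 (s - 1))
  else tPred L (A t').2 (seg A (t' + 1) d)

end Resolved

/-! ### The list of resolutions -/

/-- `Resolution L lhs rhs`: the element `lhs` (a snake or band graph with a crossing self-overlap or
a self-grafting, or a pair of graphs with a crossing overlap or a grafting, all of the given class) is
resolved to `rhs = y₃₄ G₃₄ + y₅₆ G₅₆`. In the comments below, `e_i` is the sign of the interior edge
after the tile `A_i`, and `e'_i` that of the edge after `B_i`. -/
inductive Resolution (L : LabelSystem) : FullRing L → FullRing L → Prop
  /-- Two snake graphs with crossing overlap `A[s,t] = B[s',t']`. -/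
  | snakeSnake (A B : BiWord L.X L.Y) (d d' s t s' t' : ℤ)
      (hA : IsSnake L A d) (hB : IsSnake L B d')
      (hs : 1 ≤ s) (ht : t ≤ d) (hs' : 1 ≤ s') (ht' : t' ≤ d') (htt : t - s = t' - s')
      (hov : MaxAgree A B s s' (t - s) (1 < s ∧ 1 < s') (t < d ∧ t' < d'))
      (hcr : (1 < s ∧ t < d ∧ (A (s - 1)).2 ≠ (A t).2) ∨
        (1 < s' ∧ t' < d' ∧ (B (s' - 1)).2 ≠ (B t').2) ∨
        (s = 1 ∧ t < d ∧ 1 < s' ∧ t' = d' ∧ (A t).2 = (B (s' - 1)).2) ∨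
        (1 < s ∧ t = d ∧ s' = 1 ∧ t' < d' ∧ (A (s - 1)).2 = (B t').2)) :
      Resolution L (gr L (.snake (seg A 1 d)) * gr L (.snake (seg B 1 d')))
        (gr L (.snake (seg A 1 (s - 1) ++ seg B s' d')) *
            gr L (.snake (seg B 1 (s' - 1) ++ seg A s d)) +
          yC L (seg A s t) * (pairG5 L A B s s' * pairG6 L A B d d' t t'))
  /-- A snake graph and a band graph with crossing overlap `A[s,t] = B[1,t-s+1]`, which is not the
  whole band graph. -/
  | snakeBand (A B : BiWord L.X L.Y) (d d' s t : ℤ)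
      (hA : IsSnake L A d) (hB : IsBand L B d')
      (hs : 1 ≤ s) (ht : t ≤ d) (hlen : t - s + 1 < d')
      (hov : MaxAgree A B s 1 (t - s) (1 < s) (t < d))
      (hcr : (1 < s ∧ t < d ∧ (A (s - 1)).2 ≠ (A t).2) ∨
        (B 0).2 ≠ (B (t - s + 1)).2 ∨
        (1 < s ∧ t = d ∧ (A (s - 1)).2 = (B (t - s + 1)).2)) :
      Resolution L (gr L (.snake (seg A 1 d)) * gr L (.band (seg B 1 d')))
        (gr L (.snake (seg A 1 (s - 1) ++ seg B 1 d' ++ seg A s d)) +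
          yC L (seg A s t) *
            snakeBandG56 L B d s t (B 0).2 (B (t - s + 1)).2 (snakeBandWord L A B d d' s t))
  /-- A snake graph and a band graph with crossing overlap equal to the whole band graph; `A[s,t]` is
  the extension of the overlap inside the unrolled band graph. -/
  | snakeBandWhole (A B : BiWord L.X L.Y) (d d' s t : ℤ)
      (hA : IsSnake L A d) (hB : IsBand L B d')
      (hs : 1 ≤ s) (ht : t ≤ d) (hlen : d' ≤ t - s + 1)
      (hov : MaxAgree A B s 1 (t - s) (1 < s) (t < d))
      (hcr : (1 < s ∧ t < d ∧ (A (s - 1)).2 ≠ (A t).2) ∨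
        (s = 1 ∧ t < d ∧ (A t).2 = (B 0).2)) :
      Resolution L (gr L (.snake (seg A 1 d)) * gr L (.band (seg B 1 d')))
        (gr L (.snake (seg A 1 (s - 1) ++ seg B 1 d' ++ seg A s d)) +
          yC L (seg B 1 d') * gr L (.snake (seg A 1 (s - 1) ++ seg A (s + d') d)))
  /-- Two band graphs with crossing overlap `A[1,t] = B[1,t]`, which is not the whole of `B`. -/
  | bandBand (A B : BiWord L.X L.Y) (d d' t : ℤ)
      (hA : IsBand L A d) (hB : IsBand L B d') (ht : 1 ≤ t) (htd : t < d) (htd' : t < d')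
      (hov : MaxAgree A B 1 1 (t - 1) True True)
      (hcr : (B 0).2 ≠ (B t).2) :
      Resolution L (gr L (.band (seg A 1 d)) * gr L (.band (seg B 1 d')))
        (gr L (.band (seg A 1 d ++ seg B 1 d')) +
          yC L (seg A 1 t) *
            gr L (.band (withEnd (!(A 0).2) (seg A (t + 1) d) ++
              turnWord (!(A t).2) (seg B (t + 1) d'))))
  /-- Two band graphs with crossing overlap equal to the whole of `B`; `A[1,t]` is the extension of the
  overlap inside the unrolled band graph `B`. -/
  | bandBandWhole (A B : BiWord L.X L.Y) (d d' t : ℤ)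
      (hA : IsBand L A d) (hB : IsBand L B d') (htd : t < d) (htd' : d' ≤ t)
      (hov : MaxAgree A B 1 1 (t - 1) True True)
      (hcr : (A t).2 = (B 0).2) :
      Resolution L (gr L (.band (seg A 1 d)) * gr L (.band (seg B 1 d')))
        (gr L (.band (seg A 1 d ++ seg B 1 d')) +
          yC L (seg B 1 d') * gr L (.band (seg A (d' + 1) d)))
  /-- A band graph with crossing self-overlap `A[1,t] = A[s',t']` in the same direction, `s' ≤ t`. -/
  | bandSelfInter (A : BiWord L.X L.Y) (d t s' t' : ℤ)
      (hA : IsBand L A d) (hs' : 2 ≤ s') (ht : s' ≤ t) (ht' : t' = s' + t - 1) (htd : t' ≤ d)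
      (hov : MaxAgree A A 1 s' (t - 1) True True)
      (hcr : (t' < d → (A (s' - 1)).2 ≠ (A t').2) ∧ (A t).2 = (A (s' - 1)).2) :
      Resolution L (gr L (.band (seg A 1 d)))
        (gr L (.band (seg A s' d)) * gr L (.band (seg A 1 (s' - 1))) -
          yC L (seg A 1 (s' - 1)) * gr L (.band (seg A (2 * s' - 1) d)))
  /-- A band graph with crossing self-overlap `A[1,t] = A[s',t']` in the same direction,
  `t + 1 < s'`. -/
  | bandSelfDisj (A : BiWord L.X L.Y) (d t s' t' : ℤ)
      (hA : IsBand L A d) (ht : 1 ≤ t) (hs' : t + 1 < s') (ht' : t' = s' + t - 1) (htd : t' < d)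
      (hov : MaxAgree A A 1 s' (t - 1) True True)
      (hcr : (A (s' - 1)).2 ≠ (A t').2 ∧ (A t).2 = (A (s' - 1)).2) :
      Resolution L (gr L (.band (seg A 1 d)))
        (gr L (.band (seg A s' d)) * gr L (.band (seg A 1 (s' - 1))) +
          yC L (seg A 1 t) *
            gr L (.band (turnWord (!(A t').2) (seg A (t + 1) (s' - 1)) ++
              withEnd (!(A 0).2) (seg A (t' + 1) d))))
  /-- A band graph with crossing self-overlap `A[1,t] = A[t+1,d]` in the same direction. -/
  | bandSelfAdjFull (A : BiWord L.X L.Y) (d t : ℤ)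
      (hA : IsBand L A d) (ht : 1 ≤ t) (htd : 2 * t = d)
      (hov : MaxAgree A A 1 (t + 1) (t - 1) True True) :
      Resolution L (gr L (.band (seg A 1 d)))
        (gr L (.band (seg A (t + 1) d)) * gr L (.band (seg A 1 t)) - yC L (seg A 1 t))
  /-- A band graph with crossing self-overlap `A[1,t] = A[t+1,2t]` in the same direction, `2t < d`;
  `ℓ` is the smallest positive integer with `e_{2t+ℓ} = e_{d-ℓ}`. -/
  | bandSelfAdj (A : BiWord L.X L.Y) (d t ℓ : ℤ)
      (hA : IsBand L A d) (ht : 1 ≤ t) (htd : 2 * t < d)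
      (hov : MaxAgree A A 1 (t + 1) (t - 1) True True)
      (hcr : (A t).2 ≠ (A (2 * t)).2)
      (hℓ : 1 ≤ ℓ ∧ (A (2 * t + ℓ)).2 = (A (d - ℓ)).2)
      (hmin : ∀ m, 1 ≤ m → m < ℓ → (A (2 * t + m)).2 ≠ (A (d - m)).2) :
      Resolution L (gr L (.band (seg A 1 d)))
        (gr L (.band (seg A (t + 1) d)) * gr L (.band (seg A 1 t)) +
          eqSign L (A (2 * t)).2 (A (2 * t + ℓ)).2 *
            (yC L (seg A (d - ℓ + 1) d ++ seg A 1 t) *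
              (if 2 * t + 2 * ℓ < d then
                gr L (.band (withEnd (!(A (2 * t + ℓ)).2) (seg A (2 * t + ℓ + 1) (d - ℓ))))
              else if 2 * t + 2 * ℓ = d then 1 else 0)))
  /-- A band graph with crossing self-overlap in the same direction equal to the whole band graph: it
  is invariant under the rotation by `s' - 1` tiles. -/
  | bandSelfWhole (A : BiWord L.X L.Y) (d s' : ℤ)
      (hA : IsBand L A d) (hs' : 2 ≤ s') (hd : 2 * s' - 2 ≤ d)
      (hov : Agree A A 1 s' (d - 1)) (hcr : (A d).2 = (A (s' - 1)).2) :
      Resolution L (gr L (.band (seg A 1 d)))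
        (gr L (.band (seg A s' d)) * gr L (.band (seg A 1 (s' - 1))) -
          yC L (seg A 1 (s' - 1)) *
            (if 2 * s' - 1 ≤ d then gr L (.band (seg A (2 * s' - 1) d)) else 2))
  /-- A band graph with crossing self-overlap `A[1,t] = A[s',t']` in the opposite direction, with tiles
  between the two copies. -/
  | bandSelfOpp (A : BiWord L.X L.Y) (d t s' t' : ℤ)
      (hA : IsBand L A d) (ht : 1 ≤ t) (hs' : t + 1 < s') (ht' : t' = s' + t - 1) (htd : t' < d)
      (hov : MaxAgree A A.turn 1 (-t') (t - 1) True True)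
      (hcr : (A (s' - 1)).2 ≠ (A t').2 ∧ (A t).2 = (A (s' - 1)).2) :
      Resolution L (gr L (.band (seg A 1 d)))
        (gr L (.band (withEnd (!(A t).2) (seg A 1 t) ++
            turnWord (!(A (s' - 1)).2) (seg A (t + 1) (s' - 1)) ++ seg A s' d)) +
          yC L (seg A 1 t) *
            (gr L (.band (withEnd (!(A t').2) (seg A (t' + 1) d))) *
              gr L (.band (withEnd (!(A t).2) (seg A (t + 1) (s' - 1))))))
  /-- A snake graph with crossing self-overlap `A[s,t] = A[s',t']` in the same direction. The cases
  for `G₅₆` are `s' ≤ t`, `t + 1 < s'`, and four cases for `s' = t + 1`. -/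
  | snakeSelf (A : BiWord L.X L.Y) (d s t s' t' : ℤ) (G56 : FullRing L)
      (hA : IsSnake L A d) (hs : 1 ≤ s) (hss' : s < s') (hst : s ≤ t)
      (ht' : t' = s' + (t - s)) (htd : t' ≤ d)
      (hov : MaxAgree A A s s' (t - s) (1 < s) (t' < d))
      (hcr : (1 < s ∧ (A (s - 1)).2 ≠ (A t).2) ∨
        (t' < d ∧ (A (s' - 1)).2 ≠ (A t').2) ∨
        (s = 1 ∧ t' = d ∧ (A t).2 = (A (s' - 1)).2))
      (hG56 :
        (s' ≤ t ∧ G56 = -(yC L (seg A s (s' - 1)) *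
          gr L (.snake (seg A 1 (s - 1) ++ seg A (2 * s' - s) d)))) ∨
        (t + 1 < s' ∧ G56 = yC L (seg A s t) * selfG56 L A d s t s' t') ∨
        (s' = t + 1 ∧ s = 1 ∧ t' = d ∧
          G56 = -(yC L (seg A s t) * gr L (.edge ((A t).1.out (A t).2)))) ∨
        (s' = t + 1 ∧ s = 1 ∧ t' < d ∧
          G56 = -(yC L (seg A s t) * tPred L (!(A t').2) (seg A (t' + 1) d))) ∨
        (s' = t + 1 ∧ 1 < s ∧ t' = d ∧
          G56 = -(yC L (seg A s t) * tSucc L (!(A (s - 1)).2) (seg A 1 (s - 1)))) ∨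
        (s' = t + 1 ∧ 1 < s ∧ t' < d ∧ ∃ ℓ : ℤ,
          IsLeast {m : ℤ | 1 ≤ m ∧
            (m = s - 1 ∨ m = d - t' ∨ (A (t' + m)).2 = (A (s - 1 - m)).2)} ℓ ∧
          G56 = yC L (seg A (s - ℓ) t) * adjacentG56 L A d s t' ℓ)) :
      Resolution L (gr L (.snake (seg A 1 d)))
        (gr L (.snake (seg A 1 (s - 1) ++ seg A s' d)) * gr L (.band (seg A s (s' - 1))) + G56)
  /-- A snake graph with crossing self-overlap `A[s,t] = A[s',t']` in the opposite direction, with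
  tiles between the two copies. -/
  | snakeSelfOpp (A : BiWord L.X L.Y) (d s t s' t' : ℤ)
      (hA : IsSnake L A d) (hs : 1 ≤ s) (hst : s ≤ t) (hss' : t + 1 < s')
      (ht' : t' = s' + (t - s)) (htd : t' ≤ d)
      (hov : MaxAgree A A.turn s (-t') (t - s) (1 < s ∧ t' < d) True)
      (hcr : (1 < s ∧ (A (s - 1)).2 ≠ (A t).2) ∨ (t' < d ∧ (A t').2 ≠ (A (s' - 1)).2)) :
      Resolution L (gr L (.snake (seg A 1 d)))
        (gr L (.snake (withEnd (!(A t).2) (seg A 1 t) ++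
            turnWord (!(A (s' - 1)).2) (seg A (t + 1) (s' - 1)) ++ seg A s' d)) +
          yC L (seg A s t) *
            (oppositeG5 L A d s t' *
              gr L (.band (withEnd (!(A t).2) (seg A (t + 1) (s' - 1))))))
  /-- Grafting of the snake graph `B` on the snake graph `A` in the tile `A_s`, `s < d`. -/
  | graft (A B : BiWord L.X L.Y) (d d' s : ℤ) (g : Bool)
      (hA : IsSnake L A d) (hB : IsSnake L B d') (hs : 1 ≤ s) (hsd : s < d)
      (hg : g = !(A s).2)
      (h1 : JoinLabels L (A s).1 (B 1).1 g) (h2 : JoinLabels L (B 1).1.turn (A (s + 1)).1 g) :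
      Resolution L (gr L (.snake (seg A 1 d)) * gr L (.snake (seg B 1 d')))
        (gr L (.snake (withEnd g (seg A 1 s) ++ seg B 1 d')) * tPred L g (seg A (s + 1) d) +
          tSucc L g (seg A 1 s) * gr L (.snake (turnWord g (seg B 1 d') ++ seg A (s + 1) d)))
  /-- Grafting of the snake graph `B` on the snake graph `A` in its last tile. -/
  | graftEnd (A B : BiWord L.X L.Y) (d d' : ℤ) (g : Bool)
      (hA : IsSnake L A d) (hB : IsSnake L B d') (h1 : JoinLabels L (A d).1 (B 1).1 g) :
      Resolution L (gr L (.snake (seg A 1 d)) * gr L (.snake (seg B 1 d')))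
        (gr L (.snake (withEnd g (seg A 1 d) ++ seg B 1 d')) * gr L (.edge ((A d).1.out g)) +
          tSucc L g (seg A 1 d) * tPred L g (seg B 1 d'))
  /-- Grafting of a single edge on the snake graph `A` in the tile `A_k`. -/
  | graftEdge (A : BiWord L.X L.Y) (d k : ℤ) (x : L.X)
      (hA : IsSnake L A d) (hx : L.Adm (.edge x)) (hk : 1 ≤ k) (hkd : k ≤ d)
      (h1 : x = L.xOf (A k).1.face) :
      Resolution L (gr L (.edge x) * gr L (.snake (seg A 1 d)))
        (grSucc L false (seg A 1 k) * grPred L true (seg A k d) +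
          yC L (remSucc true (seg A 1 k) ++ (remPred false (seg A k d)).tail) *
            (grSucc L true (seg A 1 k) * grPred L false (seg A k d)))
  /-- Self-grafting of the snake graph `A` in the tile `A_s`, `s < d`. -/
  | selfGraft (A : BiWord L.X L.Y) (d s : ℤ) (g : Bool)
      (hA : IsSnake L A d) (hs : 1 ≤ s) (hsd : s < d) (hg : g = !(A s).2)
      (h1 : JoinLabels L (A s).1 (A 1).1 g) (h2 : JoinLabels L (A 1).1.turn (A (s + 1)).1 g) :
      Resolution L (gr L (.snake (seg A 1 d)))
        (tPred L g (seg A (s + 1) d) * gr L (.band (withEnd g (seg A 1 s))) +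
          tPred L (!g) (turnWord g (seg A 1 s) ++ seg A (s + 1) d))
  /-- Self-grafting of the snake graph `A` in its last tile. -/
  | selfGraftEnd (A : BiWord L.X L.Y) (d : ℤ) (g : Bool)
      (hA : IsSnake L A d) (h1 : JoinLabels L (A d).1 (A 1).1 g) :
      Resolution L (gr L (.snake (seg A 1 d)))
        (gr L (.edge ((A d).1.out g)) * gr L (.band (withEnd g (seg A 1 d))) +
          tMid L g (seg A 1 d))
  /-- Grafting of the snake graph `A` and the band graph `B`, whose glueing edge has sign `e'₀`. -/
  | graftBand (A B : BiWord L.X L.Y) (d d' : ℤ) (b : Bool)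
      (hA : IsSnake L A d) (hB : IsBand L B d') (hb : b = (B 0).2)
      (h1 : JoinLabels L (A d).1 (B 1).1 (!b)) (h2 : JoinLabels L (A d).1 (B d').1.turn b) :
      Resolution L (gr L (.snake (seg A 1 d)) * gr L (.band (seg B 1 d')))
        (tSucc L (!b) (withEnd (!b) (seg A 1 d) ++ seg B 1 d') +
          tSucc L b (withEnd b (seg A 1 d) ++ turnWord true (seg B 1 d')))
  /-- Grafting of a single edge and the band graph `B`, whose glueing edge has sign `e'₀`. -/
  | graftBandEdge (B : BiWord L.X L.Y) (d' : ℤ) (b : Bool) (x : L.X)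
      (hB : IsBand L B d') (hx : L.Adm (.edge x)) (hb : b = (B 0).2)
      (h1 : x = (B d').1.out (!b)) :
      Resolution L (gr L (.edge x) * gr L (.band (seg B 1 d')))
        (tPred L (!b) (seg B 1 d') +
          yC L (remSucc (!b) (seg B 1 d')) * tPred L b (lastCut (!b) (seg B 1 d')))

/-! ### Snake rings -/

/-- The ideal of resolutions: the ideal generated by all differences `lhs - rhs` for resolutions
all of whose terms lie in the ring of graphs of the given class. -/
noncomputable def resolutionIdeal (L : LabelSystem) : Ideal (GraphRing L) :=
  Ideal.span {r | ∃ lhs rhs, Resolution L lhs rhs ∧ incl L r = lhs - rhs}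

/-- The snake ring. -/
abbrev SnakeRing (L : LabelSystem) : Type := GraphRing L ⧸ resolutionIdeal L

/-- The class in the snake ring of a disjoint union of connected graphs. -/
noncomputable def unionClass (L : LabelSystem) (U : Multiset (AdmClass L)) : SnakeRing L :=
  Ideal.Quotient.mk (resolutionIdeal L) (U.map MvPolynomial.X).prod

/-- Coefficients as elements of the snake ring. -/
noncomputable def coeffClass (L : LabelSystem) (a : L.K) : SnakeRing L :=
  Ideal.Quotient.mk (resolutionIdeal L) (MvPolynomial.C a)

/-! ### Triangulated surfaces without punctures -/

/-- A triangulated connected oriented surface with boundary, all of whose marked points lie on the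
boundary: `n` triangles with sides numbered counterclockwise by `0, 1, 2`, glued (orientably) by the
involution `opp`; the fixed sides of `opp` are the boundary segments. The field `unpunctured` says
that when one turns around an endpoint of a side, from triangle to triangle, one meets the
boundary; the field `hasArc` excludes the disk with three marked points. -/
structure TriSurface where
  n : ℕ
  opp : Fin n × Fin 3 → Fin n × Fin 3
  opp_opp : Function.Involutive opp
  connected : ∀ i j : Fin n,
    Relation.ReflTransGen (fun i j => ∃ c, (opp (i, c)).1 = j) i j
  unpunctured : ∀ a, ∃ k : ℕ,
    let b := (fun a => ((opp a).1, (opp a).2 + 1))^[k] a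
    opp b = b
  hasArc : ∃ a, opp a ≠ a

namespace TriSurface

variable (T : TriSurface)

/-- Sides of the triangles. -/
abbrev Side : Type := Fin T.n × Fin 3

/-- The next side of the same triangle, counterclockwise. -/
def next (a : T.Side) : T.Side := (a.1, a.2 + 1)

/-- The previous side of the same triangle, counterclockwise. -/
def prev (a : T.Side) : T.Side := (a.1, a.2 + 2)

/-- The (interior) arcs of the triangulation: pairs of glued sides. -/
def Arc : Type := {e : Sym2 T.Side // ∃ a, T.opp a ≠ a ∧ e = s(a, T.opp a)}

/-- The arc of the triangulation crossed when leaving a triangle through a side that is not on the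
boundary. -/
def arcOf (a : T.Side) (h : T.opp a ≠ a) : T.Arc := ⟨s(a, T.opp a), a, h, rfl⟩

end TriSurface

/-- The indices `(S, M, T, i)` of the initial cluster variables, for all triangulated unpunctured
surfaces. -/
abbrev ArcIndex : Type := Σ T : TriSurface, T.Arc

/-- Edge labels: the cluster variables `some (S, M, T, i)`, and `none` for the constant `1`, the label
of the boundary segments. -/
abbrev EdgeLabel : Type := Option ArcIndex

namespace TriSurface

variable (T : TriSurface)

open Classical in
/-- The label of a side of a triangle. -/
noncomputable def edgeLabel (a : T.Side) : EdgeLabel :=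
  if h : T.opp a ≠ a then some ⟨T, T.arcOf a h⟩ else none

/-- The tile of a crossing: the curve leaves a triangle through the side `a`, and enters the triangle
on the other side of the arc. The sign `-` means to the left of the curve. -/
noncomputable def tile (a : T.Side) (h : T.opp a ≠ a) : Tile EdgeLabel ArcIndex where
  face := ⟨T, T.arcOf a h⟩
  inn s := T.edgeLabel (bif s then T.prev a else T.next a)
  out s := T.edgeLabel (bif s then T.next (T.opp a) else T.prev (T.opp a))

/-- Crossings: the curve leaves a triangle through a side that is not on the boundary. -/
abbrev Crossing : Type := {a : T.Side // T.opp a ≠ a}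

/-- The side through which the curve leaves the triangle entered by the crossing `a`, if the side of
this triangle which is not crossed lies to the left (`false`) or to the right (`true`). -/
def follow (a : T.Side) (s : Bool) : T.Side :=
  bif s then T.prev (T.opp a) else T.next (T.opp a)

/-- Crossing sequences of curves without backtracking, with the positions of the uncrossed sides. -/
def IsPath (p : List (T.Crossing × Bool)) : Prop :=
  p ≠ [] ∧ p.IsChain fun u v => v.1.1 = T.follow u.1.1 u.2

/-- Cyclic crossing sequences of closed curves without backtracking. -/
def IsLoop (p : List (T.Crossing × Bool)) : Prop :=
  T.IsPath p ∧ ∀ u ∈ p.getLast?, ∀ v ∈ p.head?, v.1.1 = T.follow u.1.1 u.2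

/-- The word of the snake or band graph of a crossing sequence. -/
noncomputable def pathWord (p : List (T.Crossing × Bool)) : Word EdgeLabel ArcIndex :=
  p.map fun u => (T.tile u.1.1 u.1.2, u.2)

end TriSurface

/-- Labelled snake and band graphs of arcs, boundary segments and closed loops in triangulated
unpunctured surfaces; the sign function has the sign `-` to the left of the curve. -/
inductive IsUnpunctured : ConnGraph EdgeLabel ArcIndex → Prop
  | edge (T : TriSurface) (a : T.Side) : IsUnpunctured (.edge (T.edgeLabel a))
  | snake (T : TriSurface) (p : List (T.Crossing × Bool)) (h : T.IsPath p) :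
      IsUnpunctured (.snake (T.pathWord p))
  | band (T : TriSurface) (p : List (T.Crossing × Bool)) (h : T.IsLoop p) :
      IsUnpunctured (.band (T.pathWord p))

/-! ### The two snake rings and the forgetful map -/

/-- Labelled unpunctured snake and band graphs, with coefficients in `ℤ[y_{S,M,T,i}]`. -/
noncomputable abbrev labeled : LabelSystem where
  X := EdgeLabel
  Y := ArcIndex
  K := MvPolynomial ArcIndex ℤ
  ring := inferInstance
  xOf := some
  y := MvPolynomial.X
  Adm := IsUnpunctured

/-- Forgetting the labels of a graph. -/
def forgetLabels : ConnClass EdgeLabel ArcIndex → ConnClass Unit Unit :=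
  ConnClass.map (fun _ => ()) (fun _ => ())

/-- Unlabelled unpunctured snake and band graphs, that is, those with an unpunctured labelling, with
integer coefficients. -/
abbrev unlabeled : LabelSystem where
  X := Unit
  Y := Unit
  K := ℤ
  ring := inferInstance
  xOf := id
  y := fun _ => 1
  Adm := fun g => ∃ g', IsUnpunctured g' ∧ forgetLabels (ConnClass.mk g') = ConnClass.mk g

/-- Forgetting the labels of an unpunctured labelled graph. -/
def forget (c : AdmClass labeled) : AdmClass unlabeled :=
  ⟨forgetLabels c.1, by
    obtain ⟨c, g, hg, rfl⟩ := c
    exact ⟨g.map (fun _ => ()) (fun _ => ()), ⟨g, hg, rfl⟩, rfl⟩⟩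

end SnakeCalculus

namespace SnakeCalculus

/-! ### Morphisms of label systems -/

/-! Every graph occurring in a resolution is cut, reversed and glued according to positions and
signs alone, so relabelling commutes with all these operations (the `full_…` lemmas). The hypotheses
of a resolution are equalities of labels, conditions on signs and positions, and membership in the
given class. All of these survive a relabelling, with one exception: an overlap has to be maximal,
and two graphs that diverge in their labels might continue to agree once the labels are gone.

This does not happen for graphs of curves. In a labelled graph the next tile is determined by the
present tile and the sign of the edge between them (`TriSurface.Consecutive.unique`): the face label
remembers the surface and the arc being crossed, and the sign says which side of the next triangle
is not crossed. Two labelled graphs that agree on an overlap and whose signs agree one step further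
therefore have the same labelled tile there. Hence an extension of the overlap without labels is
already one with labels (`maxAgree_map`).

So resolutions are sent to resolutions (`resolution_map`), and the map of polynomial rings descends
to the quotients. Uniqueness holds because the integers, the coefficients `y_i` and the connected
graphs generate the labelled ring. The argument is organised around `LabelHom`, which isolates the
properties of labels that are used; the geometry of surfaces enters only in `forgetHom`. -/

/-- Relabelling of a two-sided infinite word. -/
def BiWord.map {X Y X' Y' : Type} (f : X → X') (g : Y → Y') (A : BiWord X Y) : BiWord X' Y' :=
  fun i => ((A i).1.map f g, (A i).2)

/-! ### Operations on words commute with relabelling -/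

section MapBiWord

variable {X Y X' Y' : Type} (f : X → X') (g : Y → Y')

theorem BiWord.map_fst (A : BiWord X Y) (i : ℤ) : (A.map f g i).1 = (A i).1.map f g := rfl

theorem BiWord.map_snd (A : BiWord X Y) (i : ℤ) : (A.map f g i).2 = (A i).2 := rfl

theorem BiWord.turn_fst (A : BiWord X Y) (i : ℤ) : (A.turn i).1 = (A (-i)).1.turn := rfl

theorem BiWord.turn_snd (A : BiWord X Y) (i : ℤ) : (A.turn i).2 = !(A (-i - 1)).2 := rfl

theorem Tile.turn_turn (T : Tile X Y) : T.turn.turn = T := by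
  ext <;> simp [Tile.turn]

theorem mapWord_append (v w : Word X Y) :
    mapWord f g (v ++ w) = mapWord f g v ++ mapWord f g w :=
  List.map_append

/-- This form makes the cast of each natural index to `ℤ` explicit, so that single entries, the
first and the last, can be read off. -/
theorem seg_eq_map_range (A : BiWord X Y) (i j : ℤ) :
    seg A i j = (List.range (j + 1 - i).toNat).map fun n : ℕ => A (i + (n : ℤ)) := by
  simp only [seg, List.pure_def, List.bind_eq_flatMap, List.map_flatMap,
    List.map_cons, List.map_nil]
  induction List.range (j + 1 - i).toNat with
  | nil => rfl
  | cons n l ih => simpa using ih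

theorem mapWord_seg (A : BiWord X Y) (i j : ℤ) :
    mapWord f g (seg A i j) = seg (A.map f g) i j := by
  unfold mapWord seg
  rw [List.map_map]
  rfl

theorem length_mapWord (w : Word X Y) : (mapWord f g w).length = w.length :=
  List.length_map _

theorem mapWord_eq_nil (w : Word X Y) : mapWord f g w = [] ↔ w = [] :=
  List.map_eq_nil_iff

theorem mapWord_tail (w : Word X Y) : (mapWord f g w).tail = mapWord f g w.tail :=
  List.map_tail.symm

/-- The place of a cut is found by looking at signs only, and these are not changed. -/
theorem lastCut_mapWord (a : Bool) (w : Word X Y) :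
    lastCut a (mapWord f g w) = mapWord f g (lastCut a w) := by
  unfold lastCut mapWord List.rdropWhile
  rw [← List.map_dropLast, ← List.map_reverse, List.dropWhile_map, ← List.map_reverse]
  rfl

theorem firstCut_mapWord (a : Bool) (w : Word X Y) :
    firstCut a (mapWord f g w) = mapWord f g (firstCut a w) := by
  unfold firstCut mapWord
  rw [List.dropWhile_map, ← List.map_tail]
  rfl

theorem remSucc_mapWord (a : Bool) (w : Word X Y) :
    remSucc a (mapWord f g w) = mapWord f g (remSucc a w) := by
  unfold remSucc
  rw [lastCut_mapWord, length_mapWord]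
  split_ifs
  · exact List.map_drop.symm
  · rfl

theorem remPred_mapWord (a : Bool) (w : Word X Y) :
    remPred a (mapWord f g w) = mapWord f g (remPred a w) := by
  unfold remPred
  rw [firstCut_mapWord, length_mapWord, length_mapWord]
  split_ifs
  · exact List.map_take.symm
  · rfl

/-- Only this direction is formal. Different tiles may become equal after relabelling, which is why
maximality of overlaps needs a separate argument. -/
theorem Agree.map {A B : BiWord X Y} {i j m : ℤ} (h : Agree A B i j m) :
    Agree (A.map f g) (B.map f g) i j m :=
  ⟨fun k h0 h1 => by rw [BiWord.map_fst, BiWord.map_fst, h.1 k h0 h1], h.2⟩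

end MapBiWord

/-- A morphism of label systems: compatible relabellings of edges, faces and coefficients which
preserve the given classes of graphs. The relation `next P s Q` says that a tile `P` may be followed
by a tile `Q` across an edge of sign `s`; the source has the property that the next tile
is determined by the previous one together with the sign. -/
structure LabelHom (L L' : LabelSystem) where
  onX : L.X → L'.X
  onY : L.Y → L'.Y
  onK : L.K →+* L'.K
  onK_y : ∀ i, onK (L.y i) = L'.y (onY i)
  onX_xOf : ∀ i, onX (L.xOf i) = L'.xOf (onY i)
  adm : ∀ G, L.Adm G → L'.Adm (G.map onX onY)
  next : Tile L.X L.Y → Bool → Tile L.X L.Y → Prop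
  next_turn : ∀ P s Q, next P s Q → next Q.turn (!s) P.turn
  next_unique : ∀ P s Q Q', next P s Q → next P s Q' → Q = Q'
  next_snake : ∀ w, L.Adm (.snake w) → w.IsChain fun p q => next p.1 p.2 q.1
  next_band : ∀ w, L.Adm (.band w) → (w.IsChain fun p q => next p.1 p.2 q.1) ∧
    ∀ p ∈ w.getLast?, ∀ q ∈ w.head?, next p.1 p.2 q.1

namespace LabelHom

variable {L L' : LabelSystem} (F : LabelHom L L')

/-- The induced map on the rings of all graphs. -/
noncomputable def full : FullRing L →+* FullRing L' :=
  MvPolynomial.eval₂Hom (MvPolynomial.C.comp F.onK)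
    fun c => MvPolynomial.X (c.map F.onX F.onY)

/-- The induced map on isomorphism classes of graphs of the given classes. -/
def onAdm (c : AdmClass L) : AdmClass L' :=
  ⟨c.1.map F.onX F.onY, by
    obtain ⟨c, G, hG, rfl⟩ := c
    exact ⟨G.map F.onX F.onY, F.adm G hG, rfl⟩⟩

/-- The induced map on the rings of graphs. -/
noncomputable def onGraphs : GraphRing L →+* GraphRing L' :=
  MvPolynomial.eval₂Hom (MvPolynomial.C.comp F.onK) fun c => MvPolynomial.X (F.onAdm c)

/-- Resolutions are stated in the ring of all graphs, the ideal lives in the ring of admissible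
ones; this square moves generators of the ideal between the two. -/
theorem incl_onGraphs (r : GraphRing L) : incl L' (F.onGraphs r) = F.full (incl L r) := by
  have h : ((incl L' : GraphRing L' →+* FullRing L').comp F.onGraphs) =
      F.full.comp (incl L : GraphRing L →+* FullRing L) := by
    apply MvPolynomial.ringHom_ext
    · intro a
      simp [onGraphs, full, incl]
    · intro c
      simp [onGraphs, full, incl, onAdm]
  exact DFunLike.congr_fun h r

/-! ### Naturality of the terms of the resolutions -/

theorem full_gr (G : ConnGraph L.X L.Y) : F.full (gr L G) = gr L' (G.map F.onX F.onY) :=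
  MvPolynomial.eval₂Hom_X' _ _ _

theorem full_gr_edge (x : L.X) : F.full (gr L (.edge x)) = gr L' (.edge (F.onX x)) :=
  F.full_gr _

theorem full_gr_snake (w : Word L.X L.Y) :
    F.full (gr L (.snake w)) = gr L' (.snake (mapWord F.onX F.onY w)) :=
  F.full_gr _

theorem full_gr_band (w : Word L.X L.Y) :
    F.full (gr L (.band w)) = gr L' (.band (mapWord F.onX F.onY w)) :=
  F.full_gr _

theorem full_yC (w : Word L.X L.Y) :
    F.full (yC L w) = yC L' (mapWord F.onX F.onY w) := by
  unfold yC yProd full mapWord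
  rw [MvPolynomial.coe_eval₂Hom, MvPolynomial.eval₂_C, RingHom.comp_apply, map_list_prod,
    List.map_map, List.map_map]
  congr 2
  refine List.map_congr_left fun p _ => ?_
  exact F.onK_y p.1.face

theorem full_eqSign (a b : Bool) : F.full (eqSign L a b) = eqSign L' a b := by
  unfold eqSign
  split_ifs <;> simp

theorem full_grSucc (a : Bool) (w : Word L.X L.Y) :
    F.full (grSucc L a w) = grSucc L' a (mapWord F.onX F.onY w) := by
  unfold grSucc
  rw [lastCut_mapWord]
  cases w with
  | nil => simp [mapWord]
  | cons p w =>
    cases h : lastCut a (p :: w) with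
    | nil => simp [mapWord, full_gr_edge, Tile.map]
    | cons q l => simp [mapWord, full_gr_snake]

theorem full_grPred (a : Bool) (w : Word L.X L.Y) :
    F.full (grPred L a w) = grPred L' a (mapWord F.onX F.onY w) := by
  unfold grPred
  rw [firstCut_mapWord]
  have h1 : (mapWord F.onX F.onY w).getLast? =
    w.getLast?.map fun p => (p.1.map F.onX F.onY, p.2) := by simp [mapWord]
  rw [h1]
  cases w.getLast? with
  | none => simp
  | some p =>
    cases h : firstCut a w with
    | nil => simp [mapWord, full_gr_edge, Tile.map]
    | cons q l => simp [mapWord, full_gr_snake]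

theorem full_tSucc (a : Bool) (w : Word L.X L.Y) :
    F.full (tSucc L a w) = tSucc L' a (mapWord F.onX F.onY w) := by
  simp only [tSucc, map_mul, full_yC, full_grSucc, remSucc_mapWord]

theorem full_tPred (a : Bool) (w : Word L.X L.Y) :
    F.full (tPred L a w) = tPred L' a (mapWord F.onX F.onY w) := by
  simp only [tPred, map_mul, full_yC, full_grPred, remPred_mapWord]

theorem full_tMid (a : Bool) (w : Word L.X L.Y) :
    F.full (tMid L a w) = tMid L' a (mapWord F.onX F.onY w) := by
  simp only [tMid, apply_ite F.full, map_zero, map_mul, full_yC, full_tSucc, remPred_mapWord,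
    firstCut_mapWord, mapWord_eq_nil]

variable (A B : BiWord L.X L.Y)

theorem full_pairG5 (s s' : ℤ) :
    F.full (pairG5 L A B s s') =
      pairG5 L' (A.map F.onX F.onY) (B.map F.onX F.onY) s s' := by
  simp only [pairG5, apply_ite F.full, full_gr_snake, full_tSucc, mapWord_append, mapWord_withEnd,
    mapWord_turnWord, mapWord_seg, BiWord.map_snd]

theorem full_pairG6 (d d' t t' : ℤ) :
    F.full (pairG6 L A B d d' t t') =
      pairG6 L' (A.map F.onX F.onY) (B.map F.onX F.onY) d d' t t' := by
  simp only [pairG6, apply_ite F.full, full_gr_snake, full_tPred, mapWord_append,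
    mapWord_turnWord, mapWord_seg, BiWord.map_snd]

theorem mapWord_snakeBandWord (d d' s t : ℤ) :
    mapWord F.onX F.onY (snakeBandWord L A B d d' s t) =
      snakeBandWord L' (A.map F.onX F.onY) (B.map F.onX F.onY) d d' s t := by
  simp only [snakeBandWord, mapWord_append, mapWord_withEnd,
    mapWord_turnWord, mapWord_seg, BiWord.map_snd]

/-- Besides positions, the case distinction asks whether a cut word is empty; this too is invariant,
since relabelling preserves lengths. -/
theorem full_snakeBandG56 (d s t : ℤ) (b κ : Bool) (l : Word L.X L.Y) :
    F.full (snakeBandG56 L B d s t b κ l) =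
      snakeBandG56 L' (B.map F.onX F.onY) d s t b κ (mapWord F.onX F.onY l) := by
  simp only [snakeBandG56, apply_ite F.full, map_mul, full_gr_snake, full_gr_edge, full_yC,
    full_tSucc, full_tPred, remPred_mapWord, remSucc_mapWord, firstCut_mapWord, lastCut_mapWord,
    ne_eq, mapWord_eq_nil, BiWord.map_fst, Tile.map]

theorem full_selfG56 (d s t s' t' : ℤ) :
    F.full (selfG56 L A d s t s' t') = selfG56 L' (A.map F.onX F.onY) d s t s' t' := by
  simp only [selfG56, apply_ite F.full, full_gr_snake, full_tSucc, full_tPred, full_tMid,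
    mapWord_append, mapWord_withEnd, mapWord_turnWord, mapWord_seg, BiWord.map_snd]

theorem full_adjacentG56 (d s t' ℓ : ℤ) :
    F.full (adjacentG56 L A d s t' ℓ) = adjacentG56 L' (A.map F.onX F.onY) d s t' ℓ := by
  simp only [adjacentG56, apply_ite F.full, map_mul, map_zero, full_eqSign, full_gr_snake,
    full_tSucc, full_tPred, mapWord_append, mapWord_withEnd, mapWord_seg, BiWord.map_snd]

theorem full_oppositeG5 (d s t' : ℤ) :
    F.full (oppositeG5 L A d s t') = oppositeG5 L' (A.map F.onX F.onY) d s t' := by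
  simp only [oppositeG5, apply_ite F.full, full_gr_snake,
    full_tSucc, full_tPred, mapWord_append, mapWord_withEnd, mapWord_seg, BiWord.map_snd]

/-! ### Overlaps stay maximal after relabelling -/

theorem isSnake_map {A : BiWord L.X L.Y} {d : ℤ} (h : IsSnake L A d) :
    IsSnake L' (A.map F.onX F.onY) d :=
  ⟨h.1, by rw [← mapWord_seg]; exact F.adm _ h.2⟩

theorem isBand_map {A : BiWord L.X L.Y} {d : ℤ} (h : IsBand L A d) :
    IsBand L' (A.map F.onX F.onY) d :=
  ⟨h.1, fun i => by unfold BiWord.map; rw [h.2.1 i],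
    by rw [← mapWord_seg]; exact F.adm _ h.2.2⟩

theorem joinLabels_map {P Q : Tile L.X L.Y} {s : Bool} (h : JoinLabels L P Q s) :
    JoinLabels L' (P.map F.onX F.onY) (Q.map F.onX F.onY) s := by
  obtain ⟨h1, h2, h3⟩ := h
  refine ⟨congrArg F.onX h1, ?_, ?_⟩
  · exact (congrArg F.onX h2).trans (F.onX_xOf _)
  · exact (congrArg F.onX h3).trans (F.onX_xOf _)

/-! ### Consecutive tiles in unrolled snake and band graphs -/

/-- The tiles `A_i` and `A_{i+1}` are consecutive. -/
def NextAt (A : BiWord L.X L.Y) (i : ℤ) : Prop := F.next (A i).1 (A i).2 (A (i + 1)).1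

variable {A B}

theorem NextAt.turn {i : ℤ} (h : F.NextAt A (-i - 1)) : F.NextAt A.turn i := by
  have := F.next_turn _ _ _ h
  unfold NextAt
  rw [BiWord.turn_fst, BiWord.turn_fst, BiWord.turn_snd, show -(i + 1) = -i - 1 by ring]
  rwa [show -i - 1 + 1 = -i by ring] at this

theorem NextAt.eq_next {i j : ℤ} (hA : F.NextAt A i) (hB : F.NextAt B j)
    (h1 : (A i).1 = (B j).1) (h2 : (A i).2 = (B j).2) : (A (i + 1)).1 = (B (j + 1)).1 := by
  unfold NextAt at hA hB
  rw [← h1, ← h2] at hB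
  exact F.next_unique _ _ _ _ hA hB

/-- Going backwards is going forwards in the reversed graphs, so uniqueness of the successor also
gives uniqueness of the predecessor; `Tile.turn` is injective, being an involution. -/
theorem NextAt.eq_prev {i j : ℤ} (hA : F.NextAt A i) (hB : F.NextAt B j)
    (h1 : (A (i + 1)).1 = (B (j + 1)).1) (h2 : (A i).2 = (B j).2) : (A i).1 = (B j).1 := by
  have hA' := F.next_turn _ _ _ hA
  have hB' := F.next_turn _ _ _ hB
  rw [← h1, ← h2] at hB'
  have := congrArg Tile.turn (F.next_unique _ _ _ _ hA' hB')
  rwa [Tile.turn_turn, Tile.turn_turn] at this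

/-- The last position `j` is excluded: the chain condition relates only neighbours inside the
segment. -/
theorem nextAt_of_isChain {i j k : ℤ}
    (h : (seg A i j).IsChain fun p q => F.next p.1 p.2 q.1) (hk : i ≤ k) (hk' : k < j) :
    F.NextAt A k := by
  rw [List.isChain_iff_getElem] at h
  have hl : (k - i).toNat + 1 < (seg A i j).length := by
    simp only [seg_eq_map_range, List.length_map, List.length_range]; omega
  have := h (k - i).toNat hl
  simp only [seg_eq_map_range, List.getElem_map, List.getElem_range] at this
  unfold NextAt
  rwa [show i + (((k - i).toNat : ℕ) : ℤ) = k by omega,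
    show i + (((k - i).toNat + 1 : ℕ) : ℤ) = k + 1 by omega] at this

theorem nextAt_of_isSnake {d i : ℤ} (h : IsSnake L A d) (hi : 1 ≤ i) (hi' : i < d) :
    F.NextAt A i :=
  F.nextAt_of_isChain (F.next_snake _ h.2) hi hi'

/-- One period is covered by the chain condition together with the closing condition across the
glueing edge; periodicity gives all other positions. -/
theorem nextAt_of_isBand {d : ℤ} (h : IsBand L A d) (i : ℤ) : F.NextAt A i := by
  obtain ⟨hd, hper, hadm⟩ := h
  have hmul : ∀ (n : ℤ) (j : ℤ), A (j + n * d) = A j := fun n j =>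
    (show Function.Periodic A d from hper).int_mul n j
  obtain ⟨hc, hlast⟩ := F.next_band _ hadm
  have hbase : ∀ k, 1 ≤ k → k ≤ d → F.NextAt A k := by
    intro k hk hk'
    rcases hk'.lt_or_eq with hlt | rfl
    -- In the remaining case `k = d`, the tile after the last one is the first one, and the closing
    -- condition `hlast` applies.
    · exact F.nextAt_of_isChain hc hk hlt
    · have e : seg A 1 k = (List.range k.toNat).map fun n : ℕ => A (1 + n) := by
        rw [seg_eq_map_range, show k + 1 - 1 = k by ring]
      obtain ⟨n, hn⟩ : ∃ n, k.toNat = n + 1 := ⟨k.toNat - 1, by omega⟩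
      unfold NextAt
      rw [show k + 1 = 1 + k by ring, hper 1]
      apply hlast
      · rw [e, hn, List.range_succ, List.map_append]
        simp only [List.map_cons, List.map_nil, List.getLast?_append, List.getLast?_singleton,
          Option.some_or, Option.mem_def, Option.some.injEq]
        congr 1; omega
      · rw [e, hn, List.range_succ_eq_map]
        simp
  -- `(i - 1) % d + 1` is the representative of `i` modulo `d` among `1, …, d`.
  have hm := hbase ((i - 1) % d + 1) (by have := Int.emod_nonneg (i - 1) (by omega : d ≠ 0); omega)
    (by have := Int.emod_lt_of_pos (i - 1) (by omega : 0 < d); omega)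
  have hi : i = ((i - 1) % d + 1) + ((i - 1) / d) * d := by
    have := Int.emod_add_mul_ediv (i - 1) d
    linarith
  unfold NextAt at hm ⊢
  rw [← hmul ((i - 1) / d) ((i - 1) % d + 1), ← hmul ((i - 1) / d) ((i - 1) % d + 1 + 1),
    show (i - 1) % d + 1 + 1 + (i - 1) / d * d = (i - 1) % d + 1 + (i - 1) / d * d + 1 by ring,
    ← hi] at hm
  exact hm

/-- An extension after relabelling gives equality of the sign at the new edge. The labelled tiles
inside the overlap agree already, so the labelled tile beyond that edge is forced to agree as well,
against maximality. The conditions `hpre` and `hpost` provide consecutive tiles exactly where both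
graphs continue. -/
theorem maxAgree_map {i j m : ℤ} {pre post : Prop} (h : MaxAgree A B i j m pre post)
    (hpre : pre → F.NextAt A (i - 1) ∧ F.NextAt B (j - 1))
    (hpost : post → F.NextAt A (i + m) ∧ F.NextAt B (j + m)) :
    MaxAgree (A.map F.onX F.onY) (B.map F.onX F.onY) i j m pre post := by
  obtain ⟨hm, hag, h1, h2⟩ := h
  refine ⟨hm, hag.map _ _, ?_, ?_⟩
  -- The equality of relabelled tiles is discarded; only the equality of signs is used.
  · rintro ⟨hp, -, hs⟩
    obtain ⟨nA, nB⟩ := hpre hp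
    refine h1 ⟨hp, ?_, hs⟩
    intro k hk hk'
    -- Only `k = 0` is a new tile; the others belong to the old overlap, with indices shifted by
    -- one.
    rcases hk.eq_or_lt with rfl | hk0
    · rw [add_zero, add_zero]
      refine nA.eq_prev F nB ?_ ?_
      · simpa using hag.1 0 le_rfl hm
      · simpa [BiWord.map_snd] using hs 0 le_rfl (by omega)
    · have := hag.1 (k - 1) (by omega) (by omega)
      rwa [show i + (k - 1) = i - 1 + k by ring, show j + (k - 1) = j - 1 + k by ring] at this
  · rintro ⟨hp, -, hs⟩
    obtain ⟨nA, nB⟩ := hpost hp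
    refine h2 ⟨hp, ?_, hs⟩
    intro k hk hk'
    rcases hk'.eq_or_lt with rfl | hk0
    · rw [← add_assoc, ← add_assoc]
      exact nA.eq_next F nB (hag.1 m hm le_rfl) (hs m hm (by omega))
    · exact hag.1 k hk (by omega)

end LabelHom
namespace LabelHom
variable {L L' : LabelSystem} (F : LabelHom L L')

/-! ### Relabelling preserves resolutions -/

/-- Each type of resolution goes to the same type with the same positions and signs. The only
hypotheses that are not formal are the maximality conditions, handled by `maxAgree_map`; the
graftings have none. -/
theorem resolution_map {lhs rhs : FullRing L} (h : Resolution L lhs rhs) :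
    Resolution L' (F.full lhs) (F.full rhs) := by
  cases h with
  | snakeSnake A B d d' s t s' t' hA hB hs ht hs' ht' htt hov hcr =>
    -- This gives `s ≤ t`, which is needed to see that the ends of the overlap lie inside the snake
    -- graphs.
    have hm := hov.1
    have := Resolution.snakeSnake (L := L') _ _ d d' s t s' t' (F.isSnake_map hA)
      (F.isSnake_map hB) hs ht hs' ht' htt
      (F.maxAgree_map hov
        (fun h => ⟨F.nextAt_of_isSnake hA (by omega) (by omega),
          F.nextAt_of_isSnake hB (by omega) (by omega)⟩)
        (fun h => ⟨F.nextAt_of_isSnake hA (by omega) (by omega),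
          F.nextAt_of_isSnake hB (by omega) (by omega)⟩)) hcr
    simpa only [map_add, map_mul, full_gr_snake, full_yC, full_pairG5, full_pairG6,
      mapWord_append, mapWord_seg, BiWord.map_snd] using this
  | snakeBand A B d d' s t hA hB hs ht hlen hov hcr =>
    have hm := hov.1
    have := Resolution.snakeBand (L := L') _ _ d d' s t (F.isSnake_map hA)
      (F.isBand_map hB) hs ht hlen
      (F.maxAgree_map hov
        (fun h => ⟨F.nextAt_of_isSnake hA (by omega) (by omega), F.nextAt_of_isBand hB _⟩)
        (fun h => ⟨F.nextAt_of_isSnake hA (by omega) (by omega),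
          F.nextAt_of_isBand hB _⟩)) hcr
    simpa only [map_add, map_mul, full_gr_snake, full_gr_band, full_yC, full_snakeBandG56,
      mapWord_snakeBandWord, mapWord_append, mapWord_seg, BiWord.map_snd] using this
  | snakeBandWhole A B d d' s t hA hB hs ht hlen hov hcr =>
    have hm := hov.1
    have := Resolution.snakeBandWhole (L := L') _ _ d d' s t (F.isSnake_map hA)
      (F.isBand_map hB) hs ht hlen
      (F.maxAgree_map hov
        (fun h => ⟨F.nextAt_of_isSnake hA (by omega) (by omega), F.nextAt_of_isBand hB _⟩)
        (fun h => ⟨F.nextAt_of_isSnake hA (by omega) (by omega),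
          F.nextAt_of_isBand hB _⟩)) hcr
    simpa only [map_add, map_mul, full_gr_snake, full_gr_band, full_yC,
      mapWord_append, mapWord_seg, BiWord.map_snd] using this
  | bandBand A B d d' t hA hB ht htd htd' hov hcr =>
    have := Resolution.bandBand (L := L') _ _ d d' t (F.isBand_map hA)
      (F.isBand_map hB) ht htd htd'
      (F.maxAgree_map hov (fun _ => ⟨F.nextAt_of_isBand hA _, F.nextAt_of_isBand hB _⟩)
        (fun _ => ⟨F.nextAt_of_isBand hA _, F.nextAt_of_isBand hB _⟩)) hcr
    simpa only [map_add, map_mul, full_gr_band, full_yC, mapWord_withEnd, mapWord_turnWord,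
      mapWord_append, mapWord_seg, BiWord.map_snd] using this
  | bandBandWhole A B d d' t hA hB htd htd' hov hcr =>
    have := Resolution.bandBandWhole (L := L') _ _ d d' t (F.isBand_map hA)
      (F.isBand_map hB) htd htd'
      (F.maxAgree_map hov (fun _ => ⟨F.nextAt_of_isBand hA _, F.nextAt_of_isBand hB _⟩)
        (fun _ => ⟨F.nextAt_of_isBand hA _, F.nextAt_of_isBand hB _⟩)) hcr
    simpa only [map_add, map_mul, full_gr_band, full_yC,
      mapWord_append, mapWord_seg, BiWord.map_snd] using this
  | bandSelfInter A d t s' t' hA hs' ht ht' htd hov hcr =>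
    have := Resolution.bandSelfInter (L := L') _ d t s' t' (F.isBand_map hA) hs' ht ht' htd
      (F.maxAgree_map hov (fun _ => ⟨F.nextAt_of_isBand hA _, F.nextAt_of_isBand hA _⟩)
        (fun _ => ⟨F.nextAt_of_isBand hA _, F.nextAt_of_isBand hA _⟩)) hcr
    simpa only [map_sub, map_mul, full_gr_band, full_yC, mapWord_seg, BiWord.map_snd] using this
  | bandSelfDisj A d t s' t' hA ht hs' ht' htd hov hcr =>
    have := Resolution.bandSelfDisj (L := L') _ d t s' t' (F.isBand_map hA) ht hs' ht' htd
      (F.maxAgree_map hov (fun _ => ⟨F.nextAt_of_isBand hA _, F.nextAt_of_isBand hA _⟩)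
        (fun _ => ⟨F.nextAt_of_isBand hA _, F.nextAt_of_isBand hA _⟩)) hcr
    simpa only [map_add, map_mul, full_gr_band, full_yC, mapWord_withEnd, mapWord_turnWord,
      mapWord_append, mapWord_seg, BiWord.map_snd] using this
  | bandSelfAdjFull A d t hA ht htd hov =>
    have := Resolution.bandSelfAdjFull (L := L') _ d t (F.isBand_map hA) ht htd
      (F.maxAgree_map hov (fun _ => ⟨F.nextAt_of_isBand hA _, F.nextAt_of_isBand hA _⟩)
        (fun _ => ⟨F.nextAt_of_isBand hA _, F.nextAt_of_isBand hA _⟩))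
    simpa only [map_sub, map_mul, full_gr_band, full_yC, mapWord_seg, BiWord.map_snd] using this
  | bandSelfAdj A d t ℓ hA ht htd hov hcr hℓ hmin =>
    have := Resolution.bandSelfAdj (L := L') _ d t ℓ (F.isBand_map hA) ht htd
      (F.maxAgree_map hov (fun _ => ⟨F.nextAt_of_isBand hA _, F.nextAt_of_isBand hA _⟩)
        -- The same `ℓ` works, since it is characterised by signs only.
        (fun _ => ⟨F.nextAt_of_isBand hA _, F.nextAt_of_isBand hA _⟩)) hcr hℓ hmin
    simpa only [map_add, map_mul, map_one, map_zero, apply_ite F.full, full_eqSign,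
      full_gr_band, full_yC, mapWord_withEnd, mapWord_append, mapWord_seg, BiWord.map_snd]
      using this
  | bandSelfWhole A d s' hA hs' hd hov hcr =>
    have := Resolution.bandSelfWhole (L := L') _ d s' (F.isBand_map hA) hs' hd
      -- An overlap that is the whole band graph is not required to be maximal, so plain agreement
      -- suffices.
      (hov.map F.onX F.onY) hcr
    simpa only [map_sub, map_mul, map_ofNat, apply_ite F.full, full_gr_band, full_yC,
      mapWord_seg, BiWord.map_snd] using this
  | bandSelfOpp A d t s' t' hA ht hs' ht' htd hov hcr =>
    have := Resolution.bandSelfOpp (L := L') _ d t s' t' (F.isBand_map hA) ht hs' ht' htd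
      (F.maxAgree_map hov
        -- The second copy is read in the reversed graph, whose consecutive tiles come from those of
        -- `A`.
        (fun _ => ⟨F.nextAt_of_isBand hA _, NextAt.turn F (F.nextAt_of_isBand hA _)⟩)
        (fun _ => ⟨F.nextAt_of_isBand hA _, NextAt.turn F (F.nextAt_of_isBand hA _)⟩)) hcr
    simpa only [map_add, map_mul, full_gr_band, full_yC, mapWord_withEnd, mapWord_turnWord,
      mapWord_append, mapWord_seg, BiWord.map_snd] using this
  | snakeSelf A d s t s' t' G56 hA hs hss' hst ht' htd hov hcr hG56 =>
    have := Resolution.snakeSelf (L := L') _ d s t s' t' (F.full G56) (F.isSnake_map hA)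
      hs hss' hst ht' htd
      (F.maxAgree_map hov
        (fun h => ⟨F.nextAt_of_isSnake hA (by omega) (by omega),
          F.nextAt_of_isSnake hA (by omega) (by omega)⟩)
        (fun h => ⟨F.nextAt_of_isSnake hA (by omega) (by omega),
          F.nextAt_of_isSnake hA (by omega) (by omega)⟩)) hcr ?_
    · simpa only [map_add, map_mul, full_gr_snake, full_gr_band, full_yC,
        mapWord_append, mapWord_seg, BiWord.map_snd] using this
    · rcases hG56 with ⟨h, rfl⟩ | ⟨h, rfl⟩ | ⟨h, h', h'', rfl⟩ | ⟨h, h', h'', rfl⟩ |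
        ⟨h, h', h'', rfl⟩ | ⟨h, h', h'', ℓ, hℓ, rfl⟩
      · refine Or.inl ⟨h, ?_⟩
        simp only [map_neg, map_mul, full_gr_snake, full_yC, mapWord_append, mapWord_seg]
      · refine Or.inr (Or.inl ⟨h, ?_⟩)
        simp only [map_mul, full_selfG56, full_yC, mapWord_seg]
      · refine Or.inr (Or.inr (Or.inl ⟨h, h', h'', ?_⟩))
        simp only [map_neg, map_mul, full_gr_edge, full_yC, mapWord_seg, BiWord.map_fst,
          BiWord.map_snd, Tile.map]
      · refine Or.inr (Or.inr (Or.inr (Or.inl ⟨h, h', h'', ?_⟩)))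
        simp only [map_neg, map_mul, full_tPred, full_yC, mapWord_seg, BiWord.map_snd]
      · refine Or.inr (Or.inr (Or.inr (Or.inr (Or.inl ⟨h, h', h'', ?_⟩))))
        simp only [map_neg, map_mul, full_tSucc, full_yC, mapWord_seg, BiWord.map_snd]
      · refine Or.inr (Or.inr (Or.inr (Or.inr (Or.inr ⟨h, h', h'', ℓ, hℓ, ?_⟩))))
        simp only [map_mul, full_adjacentG56, full_yC, mapWord_seg]
  | snakeSelfOpp A d s t s' t' hA hs hst hss' ht' htd hov hcr =>
    have := Resolution.snakeSelfOpp (L := L') _ d s t s' t' (F.isSnake_map hA)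
      hs hst hss' ht' htd
      (F.maxAgree_map hov
        (fun h => ⟨F.nextAt_of_isSnake hA (by omega) (by omega),
          NextAt.turn F (F.nextAt_of_isSnake hA (by omega) (by omega))⟩)
        -- At the inner end both copies continue because there are tiles between them: the positions
        -- are `t` and, before reversal, `s' - 1`.
        (fun _ => ⟨F.nextAt_of_isSnake hA (by omega) (by omega),
          NextAt.turn F (F.nextAt_of_isSnake hA (by omega) (by omega))⟩)) hcr
    simpa only [map_add, map_mul, full_gr_snake, full_gr_band, full_yC, full_oppositeG5,
      mapWord_withEnd, mapWord_turnWord, mapWord_append, mapWord_seg, BiWord.map_snd] using this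
  | graft A B d d' s g hA hB hs hsd hg h1 h2 =>
    have := Resolution.graft (L := L') _ _ d d' s g (F.isSnake_map hA) (F.isSnake_map hB) hs hsd hg
      (F.joinLabels_map h1) (F.joinLabels_map h2)
    simpa only [map_add, map_mul, full_gr_snake, full_tPred, full_tSucc,
      mapWord_withEnd, mapWord_turnWord, mapWord_append, mapWord_seg, BiWord.map_snd] using this
  | graftEnd A B d d' g hA hB h1 =>
    have := Resolution.graftEnd (L := L') _ _ d d' g (F.isSnake_map hA) (F.isSnake_map hB)
      (F.joinLabels_map h1)
    simpa only [map_add, map_mul, full_gr_snake, full_gr_edge, full_tPred, full_tSucc,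
      mapWord_withEnd, mapWord_append, mapWord_seg, BiWord.map_fst, Tile.map] using this
  | graftEdge A d k x hA hx hk hkd h1 =>
    have := Resolution.graftEdge (L := L') _ d k (F.onX x) (F.isSnake_map hA) (F.adm _ hx) hk hkd
      ((congrArg F.onX h1).trans (F.onX_xOf _))
    simpa only [map_add, map_mul, full_gr_snake, full_gr_edge, full_grPred, full_grSucc, full_yC,
      remSucc_mapWord, remPred_mapWord, mapWord_tail, mapWord_append, ← mapWord_seg, BiWord.map_snd] using this
  | selfGraft A d s g hA hs hsd hg h1 h2 =>
    have := Resolution.selfGraft (L := L') _ d s g (F.isSnake_map hA) hs hsd hg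
      (F.joinLabels_map h1) (F.joinLabels_map h2)
    simpa only [map_add, map_mul, full_gr_snake, full_gr_band, full_tPred,
      mapWord_withEnd, mapWord_turnWord, mapWord_append, mapWord_seg, BiWord.map_snd] using this
  | selfGraftEnd A d g hA h1 =>
    have := Resolution.selfGraftEnd (L := L') _ d g (F.isSnake_map hA) (F.joinLabels_map h1)
    simpa only [map_add, map_mul, full_gr_snake, full_gr_band, full_gr_edge, full_tMid,
      mapWord_withEnd, mapWord_seg, BiWord.map_fst, Tile.map] using this
  | graftBand A B d d' b hA hB hb h1 h2 =>
    have := Resolution.graftBand (L := L') _ _ d d' b (F.isSnake_map hA) (F.isBand_map hB) hb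
      (F.joinLabels_map h1) (F.joinLabels_map h2)
    simpa only [map_add, map_mul, full_gr_snake, full_gr_band, full_tSucc,
      mapWord_withEnd, mapWord_turnWord, mapWord_append, mapWord_seg, BiWord.map_snd] using this
  | graftBandEdge B d' b x hB hx hb h1 =>
    have := Resolution.graftBandEdge (L := L') _ d' b (F.onX x) (F.isBand_map hB) (F.adm _ hx) hb
      (congrArg F.onX h1)
    simpa only [map_add, map_mul, full_gr_edge, full_gr_band, full_tPred, full_yC,
      remSucc_mapWord, lastCut_mapWord, ← mapWord_seg, BiWord.map_snd] using this

/-! ### The induced map on quotients -/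

/-- The induced homomorphism of snake rings. -/
noncomputable def onSnakeRings : SnakeRing L →+* SnakeRing L' :=
  Ideal.quotientMap (resolutionIdeal L') F.onGraphs <| by
    refine Ideal.span_le.2 ?_
    rintro r ⟨lhs, rhs, h, hr⟩
    refine Ideal.subset_span ⟨_, _, F.resolution_map h, ?_⟩
    rw [incl_onGraphs, hr, map_sub]

theorem onSnakeRings_coeffClass (a : L.K) :
    F.onSnakeRings (coeffClass L a) = coeffClass L' (F.onK a) := by
  simp [onSnakeRings, coeffClass, onGraphs]

theorem onSnakeRings_unionClass (U : Multiset (AdmClass L)) :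
    F.onSnakeRings (unionClass L U) = unionClass L' (U.map F.onAdm) := by
  simp [onSnakeRings, unionClass, onGraphs, map_multiset_prod]

end LabelHom

namespace TriSurface

variable {T : TriSurface}

/-! ### Consecutive tiles of crossing sequences -/

/-- A curve crossing `a` and then `T.follow a s` crosses, when reversed, the same two arcs from
their other sides and in the other order; left and right are exchanged, hence the sign `!s`. -/
theorem opp_follow (a : T.Side) (s : Bool) :
    T.opp a = follow T (T.opp (T.follow a s)) (!s) := by
  have h1 : ∀ c : Fin 3, c + 2 + 1 = c := by decide
  have h2 : ∀ c : Fin 3, c + 1 + 2 = c := by decide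
  cases s <;> simp [follow, T.opp_opp _, next, prev, h1, h2]

theorem opp_opp_ne {a : T.Side} (h : T.opp a ≠ a) : T.opp (T.opp a) ≠ T.opp a := by
  rw [T.opp_opp]; exact h.symm

theorem edgeLabel_opp (a : T.Side) : T.edgeLabel (T.opp a) = T.edgeLabel a := by
  unfold edgeLabel
  by_cases h : T.opp a = a
  · simp [h]
  · rw [dif_pos h, dif_pos (opp_opp_ne h)]
    congr 2
    apply Subtype.ext
    simp [arcOf, T.opp_opp a, Sym2.eq_swap]

/-- The label of an arc is the unordered pair of its two sides, so it determines the side up to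
`T.opp`. This needs `a` off the boundary, as all boundary segments share one label. -/
theorem edgeLabel_eq_iff {a b : T.Side} (h : T.edgeLabel a = T.edgeLabel b)
    (ha : T.opp a ≠ a) : b = a ∨ b = T.opp a := by
  unfold edgeLabel at h
  rw [dif_pos ha] at h
  split_ifs at h with hb
  have h' := congrArg Subtype.val (eq_of_heq (Sigma.mk.inj (Option.some.inj h)).2)
  simp only [arcOf, Sym2.eq_iff] at h'
  grind

theorem face_eq_iff {a b : T.Side} {ha : T.opp a ≠ a} {hb : T.opp b ≠ b} :
    (T.tile a ha).face = (T.tile b hb).face ↔ T.edgeLabel a = T.edgeLabel b := by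
  simp [tile, edgeLabel, ha, hb]

/-- The uncrossed side is the glued edge and has sign `s`; the other edge in the north and east, of
sign `!s`, is the arc crossed next. -/
theorem tile_out_not (a : T.Side) (h : T.opp a ≠ a) (s : Bool) :
    (T.tile a h).out (!s) = T.edgeLabel (T.follow a s) := by
  cases s <;> rfl

theorem turn_tile (a : T.Side) (h : T.opp a ≠ a) :
    (T.tile a h).turn = T.tile (T.opp a) (opp_opp_ne h) := by
  refine Tile.ext ?_ ?_ ?_
  · exact face_eq_iff.2 (edgeLabel_opp a).symm
  · funext s
    cases s <;> rfl
  · funext s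
    cases s <;> simp [tile, Tile.turn, T.opp_opp a]

/-- Replacing `a` by `T.opp a` exchanges the two triangles at the arc, so two equalities of labels
account for all four edges. Such symmetric tiles do occur, for instance in the annulus with one
marked point on each boundary component. -/
theorem tile_eq_tile_opp {a : T.Side} (h : T.opp a ≠ a)
    (hn : T.edgeLabel (T.next a) = T.edgeLabel (T.next (T.opp a)))
    (hp : T.edgeLabel (T.prev a) = T.edgeLabel (T.prev (T.opp a))) :
    T.tile a h = T.tile (T.opp a) (opp_opp_ne h) := by
  refine Tile.ext (face_eq_iff.2 (edgeLabel_opp _).symm) ?_ ?_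
  · funext s
    cases s
    exacts [hn, hp]
  · funext s
    simp only [tile, T.opp_opp a]
    cases s
    exacts [hp.symm, hn.symm]

/-- If the tile of a crossing does not determine its direction, the same holds for the next tile of
a curve and of its image under the symmetry of the square. -/
theorem tile_opp_of_follow {a : T.Side} {s : Bool} {ha : T.opp a ≠ a}
    (hc : T.opp (T.follow a s) ≠ T.follow a s)
    (h : T.tile a ha = T.tile (T.opp a) (opp_opp_ne ha))
    (hf : T.follow (T.opp a) s = T.opp (T.follow a s)) :
    T.tile (T.follow a s) hc = T.tile (T.opp (T.follow a s)) (opp_opp_ne hc) := by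
  have h1 : ∀ c : Fin 3, c + 2 + 1 = c := by decide
  have h2 : ∀ c : Fin 3, c + 1 + 2 = c := by decide
  have h3 : ∀ c : Fin 3, c + 2 + 2 = c + 1 := by decide
  have h4 : ∀ c : Fin 3, c + 1 + 1 = c + 2 := by decide
  -- Of the two pairs of sides to be compared for the next tile, one consists of the two sides `a`
  -- and `T.opp a` of the crossed arc (equality `e`), the other of the uncrossed sides in the two
  -- directions (equality `hi`).
  have hi := congrFun (congrArg Tile.inn h) (!s)
  have e := edgeLabel_opp a
  apply tile_eq_tile_opp
  all_goals
    rw [← hf]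
    cases s <;> simp [tile, follow, T.opp_opp a, next, prev, h1, h2, h3, h4] at hi e ⊢ <;>
      first | exact e | exact hi.symm

/-- The tile `P` is followed by the tile `Q` along some curve, with uncrossed side in position `s`. -/
def Consecutive (P : Tile EdgeLabel ArcIndex) (s : Bool) (Q : Tile EdgeLabel ArcIndex) : Prop :=
  ∃ (T : TriSurface) (a : T.Side) (ha : T.opp a ≠ a)
    (hb : T.opp (T.follow a s) ≠ T.follow a s), P = T.tile a ha ∧ Q = T.tile (T.follow a s) hb

theorem Consecutive.turn {P Q : Tile EdgeLabel ArcIndex} {s : Bool} (h : Consecutive P s Q) :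
    Consecutive Q.turn (!s) P.turn := by
  obtain ⟨T, a, ha, hb, rfl, rfl⟩ := h
  have e := opp_follow a s
  refine ⟨T, T.opp (T.follow a s), opp_opp_ne hb, by rw [← e]; exact opp_opp_ne ha,
    turn_tile _ _, ?_⟩
  rw [turn_tile]
  congr 1

/-- The face label fixes the crossing up to its direction. If the two directions give the same tile,
the arc crossed next is still the same by its edge label; should it be crossed in opposite
directions, the symmetry of the tile `P` passes on to the next tile, so the result is again the
same. -/
theorem Consecutive.unique {P Q Q' : Tile EdgeLabel ArcIndex} {s : Bool}
    (h : Consecutive P s Q) (h' : Consecutive P s Q') : Q = Q' := by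
  obtain ⟨T, a, ha, hb, rfl, rfl⟩ := h
  obtain ⟨T', a', ha', hb', e, rfl⟩ := h'
  -- Face labels carry the triangulated surface as part of their index.
  obtain rfl : T = T' := congrArg Sigma.fst (congrArg Tile.face e)
  rcases edgeLabel_eq_iff (face_eq_iff.1 (congrArg Tile.face e)) ha with rfl | rfl
  · rfl
  have hl := congrFun (congrArg Tile.out e) (!s)
  rw [tile_out_not, tile_out_not] at hl
  rcases edgeLabel_eq_iff hl hb with hf | hf
  · congr 1
    exact hf.symm
  · rw [tile_opp_of_follow hb e hf]
    congr 1
    exact hf.symm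

theorem consecutive_tile {u v : T.Crossing × Bool} (h : v.1.1 = T.follow u.1.1 u.2) :
    Consecutive (T.tile u.1.1 u.1.2) u.2 (T.tile v.1.1 v.1.2) := by
  refine ⟨T, u.1.1, u.1.2, h ▸ v.1.2, rfl, ?_⟩
  congr 1

theorem isChain_pathWord {p : List (T.Crossing × Bool)} (h : T.IsPath p) :
    (T.pathWord p).IsChain fun u v => Consecutive u.1 u.2 v.1 := by
  unfold pathWord
  rw [List.isChain_map]
  exact h.2.imp fun u v huv => consecutive_tile huv

end TriSurface

/-! ### Forgetting labels -/

/-- The morphism of label systems which forgets all labels. -/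
noncomputable def forgetHom : LabelHom labeled unlabeled where
  onX _ := ()
  onY _ := ()
  onK := MvPolynomial.eval₂Hom (Int.castRingHom ℤ) fun _ => 1
  onK_y i := MvPolynomial.eval₂Hom_X' _ _ i
  onX_xOf _ := rfl
  adm G hG := ⟨G, hG, rfl⟩
  next := TriSurface.Consecutive
  next_turn _ _ _ h := h.turn
  next_unique _ _ _ _ h h' := h.unique h'
  next_snake := by
    rintro w (_ | ⟨T, p, hp⟩)
    exact TriSurface.isChain_pathWord hp
  next_band := by
    rintro w (_ | _ | ⟨T, p, hp⟩)
    refine ⟨TriSurface.isChain_pathWord hp.1, ?_⟩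
    unfold TriSurface.pathWord
    rw [List.getLast?_map, List.head?_map]
    rintro _ hu' _ hv'
    obtain ⟨u, hu, rfl⟩ := Option.map_eq_some_iff.1 hu'
    obtain ⟨v, hv, rfl⟩ := Option.map_eq_some_iff.1 hv'
    exact TriSurface.consecutive_tile (hp.2 u hu v hv)

theorem onAdm_forgetHom : forgetHom.onAdm = forget := rfl

end SnakeCalculus

/-! ### Existence and uniqueness of the forgetful homomorphism -/

theorem mainTheorem12 :
    ∃! Φ : SnakeCalculus.SnakeRing SnakeCalculus.labeled →+*
        SnakeCalculus.SnakeRing SnakeCalculus.unlabeled,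
      (∀ i : SnakeCalculus.ArcIndex,
        Φ (SnakeCalculus.coeffClass SnakeCalculus.labeled (MvPolynomial.X i)) = 1) ∧
      ∀ U : Multiset (SnakeCalculus.AdmClass SnakeCalculus.labeled),
        Φ (SnakeCalculus.unionClass SnakeCalculus.labeled U) =
          SnakeCalculus.unionClass SnakeCalculus.unlabeled (U.map SnakeCalculus.forget) := by
  open SnakeCalculus in
  refine ⟨forgetHom.onSnakeRings, ⟨fun i => ?_, fun U => ?_⟩, ?_⟩
  · rw [LabelHom.onSnakeRings_coeffClass]
    have : forgetHom.onK (MvPolynomial.X i) = 1 := forgetHom.onK_y i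
    rw [this]
    simp [coeffClass]
  · rw [LabelHom.onSnakeRings_unionClass, onAdm_forgetHom]
  · rintro Ψ ⟨h1, h2⟩
    -- Two homomorphisms are compared on generators: integers, where there is no choice, the
    -- variables `y_i`, and connected graphs.
    apply Ideal.Quotient.ringHom_ext
    apply MvPolynomial.ringHom_ext'
    · apply MvPolynomial.ringHom_ext'
      · exact RingHom.ext_int _ _
      · intro i
        have := LabelHom.onSnakeRings_coeffClass forgetHom (MvPolynomial.X i)
        have e : forgetHom.onK (MvPolynomial.X i) = 1 := forgetHom.onK_y i
        rw [e] at this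
        refine (h1 i).trans (Eq.trans ?_ this.symm)
        simp [coeffClass]
    · intro c
      -- A connected graph is the disjoint union with the single component `c`.
      have := h2 {c}
      rw [← onAdm_forgetHom, ← LabelHom.onSnakeRings_unionClass] at this
      simpa [unionClass] using this
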